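/- Let $d\ge 1$, $\lambda\in\mathbb{R}\setminus\{0\}$ and $\sigma>0$. Assume that either $\sigma$ is an integer, or there exists an integer $r$ with $2\sigma\ge r>d/2$. Let $P:\mathbb{R}^d\to\mathbb{R}$ be either linear, $P(\xi)=c\cdot\xi$ for some $c\in\mathbb{R}^d$, or constant. Consider, for $(t,x)\in\mathbb{R}_+\times\mathbb{R}^d$, the Cauchy problem $$ i\partial_t u+P(D)u=\lambda|u|^{2\sigma}u,\qquad u_{|t=0}=u_0,\qquad D=-i\nabla_x. \tag{1}$$ A solution of (1) in $C(\mathbb{R}_+;\mathcal{D}'(\mathbb{R}^d))$ is a $u$ in this space with $u(0)=u_0$ which on $(0,\infty)\times\mathbb{R}^d$ is given by a locally integrable function such that $|u|^{2\sigma}u$ is locally integrable and the equation in (1) holds in $\mathcal{D}'((0,\infty)\times\mathbb{R}^d)$. Then for every $\delta>0$ there exists $u_0\in H^{d/2}(\mathbb{R}^d)$ with $\|u_0\|_{H^{d/2}(\mathbb{R}^d)}\le\delta$ such that (1) has a unique solution $u\in C(\mathbb{R}_+;\mathcal{D}'(\mathbb{R}^d))$, and $u(t,\cdot)\notin H^{d/2}(\mathbb{R}^d)$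 for every $t>0$. -/

import Mathlib

open MeasureTheory Set TopologicalSpace Distributions FourierTransform
open scoped NNReal ENNReal SchwartzMap

noncomputable section

namespace ModifiedNLS

/-- The space variable `x` lives in `ℝ^d` with its Euclidean structure. -/
abbrev Space (d : ℕ) : Type := EuclideanSpace ℝ (Fin d)

variable {d : ℕ}

/-- The space `𝒟'(ℝ^d)` of complex-valued distributions on the whole of `ℝ^d`. -/
abbrev Distr (d : ℕ) : Type := 𝓓'((⊤ : Opens (Space d)), ℂ)

/-- A real-valued test function, seen as a complex-valued Schwartz function. -/
def testToSchwartz (φ : 𝓓((⊤ : Opens (Space d)), ℝ)) : 𝓢(Space d, ℂ) :=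
  HasCompactSupport.toSchwartzMap (f := fun x => ((φ x : ℝ) : ℂ))
    (φ.hasCompactSupport.comp_left (g := fun r : ℝ => (r : ℂ)) Complex.ofReal_zero)
    (Complex.ofRealCLM.contDiff.comp φ.contDiff)

/-- The tempered distribution `T` restricts to the distribution `u`. -/
def RestrictsTo (T : 𝓢'(Space d, ℂ)) (u : Distr d) : Prop :=
  ∀ φ : 𝓓((⊤ : Opens (Space d)), ℝ), u φ = T (testToSchwartz φ)

/-- `u ∈ H^s(ℝ^d)`: the distribution `u` is (the restriction of) a tempered distribution
in the `L²`-based Sobolev space of order `s`. -/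
def MemH (s : ℝ) (u : Distr d) : Prop :=
  ∃ T : 𝓢'(Space d, ℂ), RestrictsTo T u ∧ TemperedDistribution.MemSobolev s 2 T

/-- The norm `‖u‖_{H^s}`, the `L²` norm of the Bessel potential of order `s` of `u`; it is `∞`
if `u ∉ H^s`. -/
def normH (s : ℝ) (u : Distr d) : ℝ≥0∞ :=
  ⨅ (T : 𝓢'(Space d, ℂ)) (_ : RestrictsTo T u) (f : Lp ℂ 2 (volume : Measure (Space d)))
    (_ : TemperedDistribution.besselPotential (Space d) ℂ s T = (f : 𝓢'(Space d, ℂ))), ‖f‖ₑ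

/-- The Fourier multiplier `P(-D)`, `D = -i∇`, acting on a function on `ℝ^d`. It is the transpose
of `P(D)` for the bilinear pairing `∫ f g`. With the Fourier transform `∫ e^{-2iπ x·ξ} f(x) dx`,
the operator `D` has symbol `2πξ`. -/
def multTranspose (P : Space d → ℝ) (φ : Space d → ℂ) : Space d → ℂ :=
  𝓕⁻ (fun ξ : Space d => ((P (-((2 * Real.pi) • ξ)) : ℝ) : ℂ) * 𝓕 φ ξ)

/-- The nonlinearity `|z|^{2σ} z`. -/
def nonlin (σ : ℝ) (z : ℂ) : ℂ := ((‖z‖ ^ (2 * σ) : ℝ) : ℂ) * z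

/-- The open half space-time `(0,∞) × ℝ^d`. -/
def spaceTime (d : ℕ) : Opens (ℝ × Space d) :=
  ⟨Ioi 0 ×ˢ univ, isOpen_Ioi.prod isOpen_univ⟩

/-- `u ∈ C(ℝ₊; 𝒟'(ℝ^d))` solves `i ∂ₜu + P(D) u = lam |u|^{2σ} u`, `u(0) = u₀`.
That is: on `(0,∞) × ℝ^d`, `u` is given by a locally integrable function `U` such that
`|U|^{2σ} U` is locally integrable, and the equation holds in `𝒟'((0,∞) × ℝ^d)`. -/
structure IsSolution (P : Space d → ℝ) (lam σ : ℝ) (u₀ : Distr d) (u : C(ℝ≥0, Distr d)) :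
    Prop where
  initial : u 0 = u₀
  equation : ∃ U : ℝ × Space d → ℂ,
    LocallyIntegrableOn U (spaceTime d) ∧
    LocallyIntegrableOn (fun p => nonlin σ (U p)) (spaceTime d) ∧
    (∀ᵐ t : ℝ, 0 < t → LocallyIntegrable (fun x => U (t, x)) ∧
      ∀ φ : 𝓓((⊤ : Opens (Space d)), ℝ),
        u t.toNNReal φ = ∫ x, ((φ x : ℝ) : ℂ) * U (t, x)) ∧
    ∀ Φ : 𝓓(spaceTime d, ℂ),
      ∫ p in (spaceTime d : Set (ℝ × Space d)),
        (-(Complex.I * U p * deriv (fun s => Φ (s, p.2)) p.1)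
          + U p * multTranspose P (fun x => Φ (p.1, x)) p.2) =
      ∫ p in (spaceTime d : Set (ℝ × Space d)), (lam : ℂ) * nonlin σ (U p) * Φ p

end ModifiedNLS

end

/-!
Translating along the characteristics of `P(D)` turns the equation into the ordinary differential
equation `i w' = lam |w|^{2σ} w`, solved by the phase rotation `z ↦ e^{-i lam t |z|^{2σ}} z`, whose
speed is unbounded in `|z|`. Since `H^{d/2}` does not embed into `L^∞`, an arbitrarily small datum
can contain plateaus of arbitrarily large height `h`, each carrying small bumps of height `a`. For
every `t ≠ 0` the phases at the heights `h` and `h + a` rotate apart, which creates jumps of large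
size in the solution; they are detected by `L¹`-normalised dipoles bounded in `H^{-d/2}`.
Uniqueness holds because, for almost every starting point, a weak solution restricted to the
characteristic is a solution of the ordinary differential equation.
-/

noncomputable section

namespace ModifiedNLS

open Filter Module
open scoped ContDiff Topology LineDeriv

variable {d : ℕ}

/-- The affine symbol `P(ξ) = c·ξ + a`, which covers both the linear and the constant case. -/
def affineSymbol (c : Space d) (a : ℝ) (ξ : Space d) : ℝ := inner ℝ c ξ + a

theorem multTranspose_affineSymbol (c : Space d) (a : ℝ) (φ : 𝓢(Space d, ℂ)) (x : Space d) :
    multTranspose (affineSymbol c a) φ x = Complex.I * fderiv ℝ φ x c + a * φ x := by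
  have symbol_mul_fourier : (fun ξ : Space d =>
        ((affineSymbol c a (-((2 * Real.pi) • ξ)) : ℝ) : ℂ) * 𝓕 (φ : Space d → ℂ) ξ) =
      ((Complex.I • 𝓕 (LineDeriv.lineDerivOp c φ) + (a : ℂ) • 𝓕 φ : 𝓢(Space d, ℂ)) :
        Space d → ℂ) := by
    ext ξ
    rw [SchwartzMap.fourier_lineDerivOp_eq, affineSymbol]
    simp only [_root_.add_apply, _root_.smul_apply, smul_eq_mul]
    rw [SchwartzMap.smulLeftCLM_apply_apply (by fun_prop), SchwartzMap.fourier_coe]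
    simp only [inner_neg_right, inner_smul_right, real_inner_comm ξ c]
    push_cast
    simp only [Complex.real_smul]
    linear_combination (-2 * Real.pi * (inner ℝ ξ c : ℝ) * 𝓕 (φ : Space d → ℂ) ξ) * Complex.I_sq
  rw [multTranspose, symbol_mul_fourier, ← SchwartzMap.fourierInv_coe]
  simp only [FourierTransform.fourierInv_add, FourierTransform.fourierInv_smul,
    FourierTransform.fourierInv_fourier_eq]
  simp [SchwartzMap.lineDerivOp_apply_eq_fderiv]

/-! ### Dilations in Sobolev spaces -/

section Weight

theorem pow_eq_sq_rpow_half {r : ℝ} (hr : 0 ≤ r) (n : ℕ) : r ^ n = (r ^ 2) ^ ((n : ℝ) / 2) := by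
  rw [← Real.rpow_natCast_mul hr, Nat.cast_ofNat, mul_div_cancel₀ _ two_ne_zero,
    Real.rpow_natCast]

variable {E : Type*} [NormedAddCommGroup E]

theorem one_add_norm_sq_rpow_neg_half_le {ξ : E} (hξ : ξ ≠ 0) (n : ℕ) :
    (1 + ‖ξ‖ ^ 2) ^ (-((n : ℝ) / 2)) ≤ (‖ξ‖ ^ n)⁻¹ := by
  have hξ' : 0 < ‖ξ‖ := norm_pos_iff.2 hξ
  rw [Real.rpow_neg (by positivity), pow_eq_sq_rpow_half hξ'.le n]
  gcongr
  linarith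

theorem one_add_norm_sq_rpow_half_le [NormedSpace ℝ E] {M : ℝ} (hM : 1 ≤ M) (ξ : E) (n : ℕ) :
    (1 + ‖ξ‖ ^ 2) ^ ((n : ℝ) / 2) ≤ M ^ n * (1 + ‖M⁻¹ • ξ‖ ^ 2) ^ ((n : ℝ) / 2) := by
  have hM0 : 0 < M := by linarith
  have rescaled : M ^ 2 * (1 + ‖M⁻¹ • ξ‖ ^ 2) = M ^ 2 + ‖ξ‖ ^ 2 := by
    rw [norm_smul, norm_inv, Real.norm_of_nonneg hM0.le]
    field_simp
  rw [pow_eq_sq_rpow_half hM0.le n, ← Real.mul_rpow (by positivity) (by positivity), rescaled]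
  gcongr
  exact one_le_pow₀ hM

end Weight

section Sobolev

variable {E : Type*} [NormedAddCommGroup E] [InnerProductSpace ℝ E]

/-- The function `x ↦ f (M (x - x₀))`; the scale is a unit so that this is again a Schwartz
function. -/
def dilate (M : ℝˣ) (x₀ : E) (f : 𝓢(E, ℂ)) : 𝓢(E, ℂ) :=
  (SchwartzMap.compCLMOfContinuousLinearEquiv ℂ
    (ContinuousLinearEquiv.smulLeft (R₁ := ℝ) M) f).compSubConstCLM ℂ x₀

theorem dilate_apply (M : ℝˣ) (x₀ : E) (f : 𝓢(E, ℂ)) (x : E) :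
    dilate M x₀ f x = f ((M : ℝ) • (x - x₀)) := rfl

variable [FiniteDimensional ℝ E] [MeasurableSpace E] [BorelSpace E]

/-- The Bessel potential `(1 - Δ / (2π)²)^{s/2}` on Schwartz functions; Mathlib's
`TemperedDistribution.besselPotential` extends it to tempered distributions. -/
def bessel (s : ℝ) : 𝓢(E, ℂ) →L[ℂ] 𝓢(E, ℂ) :=
  SchwartzMap.fourierMultiplierCLM ℂ (fun x : E ↦ (((1 + ‖x‖ ^ 2) ^ (s / 2) : ℝ) : ℂ))

/-- The Bessel potential of a Schwartz function as an element of `L²`, so that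
`‖besselL2 s f‖` is the `H^s` norm of `f`. -/
def besselL2 (s : ℝ) : 𝓢(E, ℂ) →L[ℂ] Lp ℂ 2 (volume : Measure E) :=
  SchwartzMap.toLpCLM ℂ ℂ 2 volume ∘L bessel s

theorem besselL2_apply (s : ℝ) (f : 𝓢(E, ℂ)) : besselL2 s f = (bessel s f).toLp 2 := rfl

theorem fourier_bessel_apply (s : ℝ) (f : 𝓢(E, ℂ)) (ξ : E) :
    𝓕 (bessel s f) ξ = (((1 + ‖ξ‖ ^ 2) ^ (s / 2) : ℝ) : ℂ) * 𝓕 f ξ := by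
  rw [bessel, SchwartzMap.fourierMultiplierCLM_apply, FourierTransform.fourier_fourierInv_eq,
    SchwartzMap.smulLeftCLM_apply_apply (by fun_prop), smul_eq_mul]

theorem besselPotential_coe (s : ℝ) (f : 𝓢(E, ℂ)) :
    TemperedDistribution.besselPotential E ℂ s (f : 𝓢'(E, ℂ)) = (besselL2 s f : 𝓢'(E, ℂ)) := by
  rw [besselL2_apply, TemperedDistribution.besselPotential, Lp.toTemperedDistribution_toLp_eq,
    TemperedDistribution.fourierMultiplierCLM_toTemperedDistributionCLM_eq (by fun_prop)]
  rfl

theorem inner_besselL2 (s : ℝ) (f g : 𝓢(E, ℂ)) :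
    inner ℂ (besselL2 s f) (besselL2 s g) =
      ∫ ξ : E, (((1 + ‖ξ‖ ^ 2) ^ s : ℝ) : ℂ) * (𝓕 g ξ * (starRingEnd ℂ) (𝓕 f ξ)) := by
  rw [besselL2_apply, besselL2_apply, ← SchwartzMap.inner_fourier_toL2_eq]
  refine (SchwartzMap.inner_toL2_toL2_eq _ _ volume).trans ?_
  congr 1 with ξ
  have weight_split : (1 + ‖ξ‖ ^ 2) ^ s = (1 + ‖ξ‖ ^ 2) ^ (s / 2) * (1 + ‖ξ‖ ^ 2) ^ (s / 2) := by
    rw [← Real.rpow_add (by positivity), add_halves]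
  rw [fourier_bessel_apply, fourier_bessel_apply, weight_split]
  simp only [RCLike.inner_apply, map_mul, Complex.conj_ofReal]
  push_cast
  ring

theorem norm_besselL2_sq (s : ℝ) (f : 𝓢(E, ℂ)) :
    ‖besselL2 s f‖ ^ 2 = ∫ ξ : E, (1 + ‖ξ‖ ^ 2) ^ s * ‖𝓕 f ξ‖ ^ 2 := by
  have h := inner_besselL2 s f f
  rw [inner_self_eq_norm_sq_to_K] at h
  apply Complex.ofReal_injective
  rw [← integral_complex_ofReal]
  push_cast at h ⊢
  rw [← Complex.coe_algebraMap] at h ⊢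
  refine h.trans (integral_congr_ae (.of_forall fun ξ => ?_))
  simp [Complex.mul_conj, Complex.normSq_eq_norm_sq]

theorem fourier_dilate (M : ℝˣ) (x₀ : E) (f : 𝓢(E, ℂ)) (ξ : E) :
    𝓕 (dilate M x₀ f) ξ = Real.fourierChar (-inner ℝ x₀ ξ) •
      (|(M : ℝ)| ^ finrank ℝ E)⁻¹ • 𝓕 f ((M : ℝ)⁻¹ • ξ) := by
  have integrand_shift : ∀ v : E,
      Real.fourierChar (-inner ℝ (v + x₀) ξ) • dilate M x₀ f (v + x₀) =
      (Real.fourierChar (-inner ℝ x₀ ξ) : ℂ) • (fun u : E =>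
        Real.fourierChar (-inner ℝ u ((M : ℝ)⁻¹ • ξ)) • f u) ((M : ℝ) • v) := by
    intro v
    simp only [dilate_apply, add_sub_cancel_right, inner_add_left, neg_add, inner_smul_left,
      inner_smul_right]
    rw [← Circle.smul_def, smul_smul, ← AddChar.map_add_eq_mul, add_comm]
    congr 3
    simp
  rw [SchwartzMap.fourier_coe, Real.fourier_eq, SchwartzMap.fourier_coe, Real.fourier_eq,
    ← integral_add_right_eq_self _ x₀]
  simp_rw [integrand_shift]
  rw [integral_smul, Circle.smul_def]
  congr 1
  refine (Measure.integral_comp_smul volume (fun u : E =>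
    Real.fourierChar (-inner ℝ u ((M : ℝ)⁻¹ • ξ)) • f u) (M : ℝ)).trans ?_
  rw [abs_inv, abs_pow]

theorem norm_fourier_dilate (M : ℝˣ) (x₀ : E) (f : 𝓢(E, ℂ)) (ξ : E) :
    ‖𝓕 (dilate M x₀ f) ξ‖ = (|(M : ℝ)| ^ finrank ℝ E)⁻¹ * ‖𝓕 f ((M : ℝ)⁻¹ • ξ)‖ := by
  rw [fourier_dilate]
  simp [Circle.norm_smul]

theorem integrable_weight_mul_norm_fourier (s : ℝ) (f : 𝓢(E, ℂ)) :
    Integrable (fun ξ : E => (1 + ‖ξ‖ ^ 2) ^ s * ‖𝓕 f ξ‖) := by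
  have temperate_weight : Function.HasTemperateGrowth
      (fun x : E ↦ (((1 + ‖x‖ ^ 2) ^ s : ℝ) : ℂ)) := by
    have := Function.hasTemperateGrowth_one_add_norm_sq_rpow E s
    fun_prop
  have h := (SchwartzMap.integrable (μ := volume) (SchwartzMap.smulLeftCLM ℂ
    (fun x : E ↦ (((1 + ‖x‖ ^ 2) ^ s : ℝ) : ℂ)) (𝓕 f))).norm
  refine h.congr (.of_forall fun ξ => ?_)
  dsimp only
  rw [SchwartzMap.smulLeftCLM_apply_apply temperate_weight, smul_eq_mul, norm_mul,
    Complex.norm_real, Real.norm_of_nonneg (by positivity)]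

theorem exists_norm_inner_besselL2_dilate_le (φ : 𝓢(E, ℂ)) :
    ∃ C : ℝ, 0 ≤ C ∧ ∀ M M' : ℝˣ, (1 : ℝ) ≤ M → (1 : ℝ) ≤ M' → ∀ x₀ : E,
      ‖inner ℂ (besselL2 ((finrank ℝ E : ℝ) / 2) (dilate M x₀ φ))
        (besselL2 ((finrank ℝ E : ℝ) / 2) (dilate M' x₀ φ))‖ ≤
          C * ((M : ℝ) / M') ^ finrank ℝ E := by
  set n := finrank ℝ E
  set g : E → ℝ := fun ξ => (1 + ‖ξ‖ ^ 2) ^ ((n : ℝ) / 2) * ‖𝓕 φ ξ‖ with hg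
  have hgi : Integrable g := integrable_weight_mul_norm_fourier _ φ
  set S : ℝ := SchwartzMap.seminorm ℝ 0 0 (𝓕 φ)
  have hS0 : 0 ≤ S := apply_nonneg _ _
  refine ⟨S * ∫ ξ, g ξ, mul_nonneg hS0 (integral_nonneg fun ξ => by positivity),
    fun M M' hM hM' x₀ => ?_⟩
  have hM0 : (0 : ℝ) < M := by linarith
  have hM'0 : (0 : ℝ) < M' := by linarith
  have norm_integrand_le : ∀ ξ : E, ‖(((1 + ‖ξ‖ ^ 2) ^ ((n : ℝ) / 2) : ℝ) : ℂ) *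
      (𝓕 (dilate M' x₀ φ) ξ * (starRingEnd ℂ) (𝓕 (dilate M x₀ φ) ξ))‖ ≤
      S * ((M' : ℝ) ^ n)⁻¹ * g ((M : ℝ)⁻¹ • ξ) := by
    intro ξ
    rw [norm_mul, norm_mul, RCLike.norm_conj, norm_fourier_dilate, norm_fourier_dilate,
      abs_of_pos hM0, abs_of_pos hM'0, Complex.norm_real, Real.norm_of_nonneg (by positivity)]
    calc _ ≤ ((M : ℝ) ^ n * (1 + ‖(M : ℝ)⁻¹ • ξ‖ ^ 2) ^ ((n : ℝ) / 2)) *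
          (((M' : ℝ) ^ n)⁻¹ * S * (((M : ℝ) ^ n)⁻¹ * ‖𝓕 φ ((M : ℝ)⁻¹ • ξ)‖)) := by
            gcongr
            · exact one_add_norm_sq_rpow_half_le hM ξ n
            · exact SchwartzMap.norm_le_seminorm ℝ _ _
      _ = _ := by rw [hg]; field_simp
  rw [inner_besselL2]
  refine (norm_integral_le_of_norm_le ?_ (.of_forall norm_integrand_le)).trans_eq ?_
  · exact (hgi.comp_smul (inv_ne_zero hM0.ne')).const_mul _
  · rw [integral_const_mul, Measure.integral_comp_inv_smul, abs_of_pos (pow_pos hM0 _),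
      smul_eq_mul, div_pow]
    ring

theorem integrable_norm_pow_neg_mul_sq [Nontrivial E] :
    Integrable (fun ξ : E => (‖ξ‖ ^ finrank ℝ E)⁻¹ * (‖ξ‖ * (1 + ‖ξ‖ ^ 2)⁻¹) ^ 2) := by
  rw [integrable_fun_norm_addHaar (volume : Measure E)
    (f := fun r : ℝ => (r ^ finrank ℝ E)⁻¹ * (r * (1 + r ^ 2)⁻¹) ^ 2)]
  refine Integrable.mono' (g := fun r : ℝ => (1 + r ^ 2)⁻¹) integrable_inv_one_add_sq.integrableOn
    (by fun_prop) ((ae_restrict_iff' measurableSet_Ioi).2 (.of_forall fun r (hr : 0 < r) => ?_))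
  obtain ⟨n, hn⟩ : ∃ n, finrank ℝ E = n + 1 := Nat.exists_eq_add_one.2 finrank_pos
  have radial_eq : r ^ n * ((r ^ (n + 1))⁻¹ * (r * (1 + r ^ 2)⁻¹) ^ 2) =
      (r * (1 + r ^ 2)⁻¹) * (1 + r ^ 2)⁻¹ := by
    field_simp
    ring
  rw [Real.norm_of_nonneg (by simp only [smul_eq_mul]; positivity), hn, add_tsub_cancel_right,
    smul_eq_mul, radial_eq]
  refine mul_le_of_le_one_left (by positivity) ?_
  rw [← div_eq_mul_inv, div_le_one (by positivity)]
  nlinarith [sq_nonneg (r - 1)]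

-- `M ^ n • dilate M x₀ ψ` is the `L¹`-normalised rescaling; since `𝓕 ψ` vanishes at the origin,
-- the logarithmic divergence of `∫ (1 + |ξ|²)^{-n/2} dξ` does not show.
theorem exists_norm_besselL2_neg_dilate_le [Nontrivial E] {ψ : 𝓢(E, ℂ)} {A : ℝ}
    (hψ : ∀ ξ, ‖𝓕 ψ ξ‖ ≤ A * (‖ξ‖ * (1 + ‖ξ‖ ^ 2)⁻¹)) :
    ∃ C : ℝ, ∀ (M : ℝˣ) (x₀ : E), ‖besselL2 (-((finrank ℝ E : ℝ) / 2))
      ((M : ℝ) ^ finrank ℝ E • dilate M x₀ ψ)‖ ≤ C := by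
  set n := finrank ℝ E with hn
  set k : E → ℝ := fun ξ => (‖ξ‖ ^ n)⁻¹ * (‖ξ‖ * (1 + ‖ξ‖ ^ 2)⁻¹) ^ 2 with hk
  refine ⟨√(A ^ 2 * ∫ ξ, k ξ), fun M x₀ => Real.le_sqrt_of_sq_le ?_⟩
  have hM : 0 < |(M : ℝ)| := abs_pos.2 M.ne_zero
  have integrand_le : ∀ ξ : E, (1 + ‖ξ‖ ^ 2) ^ (-((n : ℝ) / 2)) *
      ‖𝓕 ((M : ℝ) ^ n • dilate M x₀ ψ) ξ‖ ^ 2 ≤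
      A ^ 2 * (|(M : ℝ)| ^ n)⁻¹ * k ((M : ℝ)⁻¹ • ξ) := by
    intro ξ
    rw [FourierTransform.fourier_smul, _root_.smul_apply, norm_smul, norm_fourier_dilate,
      norm_pow, Real.norm_eq_abs, mul_inv_cancel_left₀ (by positivity)]
    rcases eq_or_ne ξ 0 with rfl | hξ
    · have fourier_zero : 𝓕 ψ 0 = 0 := by simpa using hψ 0
      simp [fourier_zero, hk]
    calc _ ≤ (‖ξ‖ ^ n)⁻¹ *
          (A * (‖(M : ℝ)⁻¹ • ξ‖ * (1 + ‖(M : ℝ)⁻¹ • ξ‖ ^ 2)⁻¹)) ^ 2 := by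
            gcongr
            · exact one_add_norm_sq_rpow_neg_half_le hξ n
            · exact hψ _
      _ = _ := by
            simp only [hk, norm_smul, norm_inv, Real.norm_eq_abs, mul_pow, inv_pow, mul_inv,
              inv_inv]
            field_simp
  rw [norm_besselL2_sq]
  refine (integral_mono_of_nonneg (.of_forall fun ξ => by positivity) ?_
    (.of_forall integrand_le)).trans_eq ?_
  · exact (integrable_norm_pow_neg_mul_sq.comp_smul (inv_ne_zero M.ne_zero)).const_mul _
  · rw [integral_const_mul, Measure.integral_comp_inv_smul, smul_eq_mul, abs_pow, ← hn]
    field_simp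

theorem norm_fourierChar_sub_one_le (r : ℝ) :
    ‖(Real.fourierChar r : ℂ) - 1‖ ≤ 2 * Real.pi * |r| := by
  rw [Real.fourierChar_apply, mul_comm _ Complex.I]
  refine Real.norm_exp_I_mul_ofReal_sub_one_le.trans_eq ?_
  rw [norm_mul, Real.norm_eq_abs, Real.norm_eq_abs, abs_of_pos Real.two_pi_pos]

theorem exists_norm_fourier_sub_translate_le (ρ : 𝓢(E, ℂ)) (e : E) :
    ∃ A : ℝ, ∀ ξ, ‖𝓕 (ρ - dilate 1 e ρ) ξ‖ ≤ A * (‖ξ‖ * (1 + ‖ξ‖ ^ 2)⁻¹) := by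
  obtain ⟨C₀, -, hC₀⟩ := (𝓕 ρ).decay 0 0
  obtain ⟨C₂, -, hC₂⟩ := (𝓕 ρ).decay 2 0
  simp only [norm_iteratedFDeriv_zero, pow_zero, one_mul] at hC₀ hC₂
  refine ⟨2 * Real.pi * ‖e‖ * (C₀ + C₂), fun ξ => ?_⟩
  have fourier_diff : 𝓕 (ρ - dilate 1 e ρ) ξ =
      -((Real.fourierChar (-inner ℝ e ξ) : ℂ) - 1) * 𝓕 ρ ξ := by
    rw [sub_eq_add_neg, FourierTransform.fourier_add, FourierTransform.fourier_neg,
      _root_.add_apply, _root_.neg_apply, fourier_dilate, Circle.smul_def]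
    simp only [Units.val_one, abs_one, one_pow, inv_one, one_smul, smul_eq_mul]
    ring
  have norm_char_le : ‖(Real.fourierChar (-inner ℝ e ξ) : ℂ) - 1‖ ≤
      2 * Real.pi * (‖e‖ * ‖ξ‖) := by
    refine (norm_fourierChar_sub_one_le _).trans ?_
    rw [abs_neg]
    gcongr
    exact abs_real_inner_le_norm e ξ
  have norm_fourier_le : ‖𝓕 ρ ξ‖ ≤ (C₀ + C₂) * (1 + ‖ξ‖ ^ 2)⁻¹ := by
    rw [← div_eq_mul_inv, le_div_iff₀ (by positivity)]
    nlinarith [hC₀ ξ, hC₂ ξ]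
  rw [fourier_diff, norm_mul, norm_neg]
  calc _ ≤ (2 * Real.pi * (‖e‖ * ‖ξ‖)) * ((C₀ + C₂) * (1 + ‖ξ‖ ^ 2)⁻¹) := by gcongr
    _ = _ := by ring

theorem norm_toTemperedDistribution_apply_le (f : Lp ℂ 2 (volume : Measure E)) (g : 𝓢(E, ℂ)) :
    ‖(f : 𝓢'(E, ℂ)) g‖ ≤ ‖(g.toLp 2 : Lp ℂ 2 (volume : Measure E))‖ * ‖f‖ := by
  have holder : ‖∫ x, g x • f x‖ₑ ≤ eLpNorm g 2 volume * eLpNorm f 2 volume := by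
    refine (enorm_integral_le_lintegral_enorm _).trans ?_
    rw [← eLpNorm_one_eq_lintegral_enorm]
    exact eLpNorm_smul_le_mul_eLpNorm (p := 2) (q := 2) (r := 1) (φ := (g : E → ℂ))
      (f := (f : E → ℂ)) (Lp.aestronglyMeasurable f) g.continuous.aestronglyMeasurable
  rw [Lp.toTemperedDistribution_apply, SchwartzMap.norm_toLp, Lp.norm_def, ← ENNReal.toReal_mul,
    ← toReal_enorm]
  exact ENNReal.toReal_mono
    (ENNReal.mul_ne_top (g.eLpNorm_lt_top 2 volume).ne (Lp.eLpNorm_ne_top f)) holder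

-- The transpose of a Fourier multiplier with an even symbol is the multiplier itself.
theorem fourier_smulLeftCLM_fourierInv (s : ℝ) (χ : 𝓢(E, ℂ)) :
    𝓕 (SchwartzMap.smulLeftCLM ℂ (fun x : E ↦ (((1 + ‖x‖ ^ 2) ^ (s / 2) : ℝ) : ℂ)) (𝓕⁻ χ)) =
      bessel s χ := by
  ext x
  rw [bessel, SchwartzMap.fourierMultiplierCLM_apply, SchwartzMap.fourierInv_coe,
    Real.fourierInv_eq_fourier_comp_neg, SchwartzMap.fourier_coe]
  refine congrArg (fun h : E → ℂ => 𝓕 h x) (funext fun ξ => ?_)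
  rw [SchwartzMap.smulLeftCLM_apply_apply (by fun_prop),
    SchwartzMap.smulLeftCLM_apply_apply (by fun_prop), norm_neg,
    SchwartzMap.fourierInv_coe, SchwartzMap.fourier_coe, Real.fourierInv_eq_fourier_neg]

theorem exists_norm_apply_le_of_memSobolev {s : ℝ} {T : 𝓢'(E, ℂ)}
    (hT : TemperedDistribution.MemSobolev s 2 T) :
    ∃ C : ℝ, 0 ≤ C ∧ ∀ χ : 𝓢(E, ℂ), ‖T χ‖ ≤ ‖besselL2 (-s) χ‖ * C := by
  obtain ⟨f, hf⟩ := hT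
  refine ⟨‖f‖, norm_nonneg f, fun χ => ?_⟩
  rw [← (TemperedDistribution.besselPotential_neg_apply_eq_iff _ _ _).2 hf,
    TemperedDistribution.besselPotential, TemperedDistribution.fourierMultiplierCLM_apply_apply,
    fourier_smulLeftCLM_fourierInv]
  exact norm_toTemperedDistribution_apply_le _ _

theorem exists_norm_apply_dilate_le [Nontrivial E] {ψ : 𝓢(E, ℂ)} {A : ℝ}
    (hψ : ∀ ξ, ‖𝓕 ψ ξ‖ ≤ A * (‖ξ‖ * (1 + ‖ξ‖ ^ 2)⁻¹)) {T : 𝓢'(E, ℂ)}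
    (hT : TemperedDistribution.MemSobolev ((finrank ℝ E : ℝ) / 2) 2 T) :
    ∃ C : ℝ, ∀ (M : ℝˣ) (x₀ : E), ‖T ((M : ℝ) ^ finrank ℝ E • dilate M x₀ ψ)‖ ≤ C := by
  obtain ⟨B, hB, hTB⟩ := exists_norm_apply_le_of_memSobolev hT
  obtain ⟨C, hC⟩ := exists_norm_besselL2_neg_dilate_le hψ
  exact ⟨C * B, fun M x₀ => (hTB _).trans (by gcongr; exact hC M x₀)⟩

end Sobolev

/-! ### Unbounded functions of small critical Sobolev norm -/

section Hilbert

variable {𝕜 H : Type*} [RCLike 𝕜] [NormedAddCommGroup H] [InnerProductSpace 𝕜 H]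

theorem norm_sq_le_of_norm_inner_le {F : ℕ → H} {C : ℝ}
    (hF : ∀ i j, i ≤ j → ‖inner 𝕜 (F i) (F j)‖ ≤ C * ((2 : ℝ) ^ i / 2 ^ j)) (j : ℕ) :
    ‖F j‖ ^ 2 ≤ C := by
  have h := hF j j le_rfl
  rw [div_self (by positivity), mul_one, inner_self_eq_norm_sq_to_K] at h
  simpa using h

theorem norm_sum_range_sq_le {F : ℕ → H} {C : ℝ}
    (hF : ∀ i j, i ≤ j → ‖inner 𝕜 (F i) (F j)‖ ≤ C * ((2 : ℝ) ^ i / 2 ^ j)) (N : ℕ) :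
    ‖∑ i ∈ Finset.range N, F i‖ ^ 2 ≤ 3 * C * N := by
  have hC : 0 ≤ C := (sq_nonneg _).trans (norm_sq_le_of_norm_inner_le hF 0)
  induction N with
  | zero => simp
  | succ N ih =>
    have norm_cross_le : ‖inner 𝕜 (∑ i ∈ Finset.range N, F i) (F N)‖ ≤ C := by
      rw [sum_inner]
      refine (norm_sum_le _ _).trans ((Finset.sum_le_sum fun i hi =>
        hF i N (Finset.mem_range.1 hi).le).trans ?_)
      rw [← Finset.mul_sum, ← Finset.sum_div, geom_sum_eq (by norm_num)]
      refine mul_le_of_le_one_right hC ?_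
      rw [div_le_one (by positivity)]
      norm_num
    have re_cross_le := (RCLike.re_le_norm _).trans norm_cross_le
    rw [Finset.sum_range_succ, norm_add_sq (𝕜 := 𝕜)]
    push_cast
    linarith [norm_sq_le_of_norm_inner_le hF N]

-- By almost orthogonality an average of `N` terms has norm `O(N^{-1/2})`, which beats any `h`.
theorem exists_norm_average_add_smul_le {C ε : ℝ} (hC : 0 ≤ C) (hε : 0 < ε) :
    ∃ η > 0, ∀ h : ℝ, ∃ N : ℕ, 0 < N ∧ ∀ F : ℕ → H,
      (∀ i j, i ≤ j → ‖inner 𝕜 (F i) (F j)‖ ≤ C * ((2 : ℝ) ^ i / 2 ^ j)) →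
      ∀ (a : 𝕜) (m : ℕ), ‖a‖ ≤ η →
        ‖((h / N : ℝ) : 𝕜) • ∑ j ∈ Finset.range N, F j + a • F m‖ ≤ ε := by
  refine ⟨ε / (2 * (√C + 1)), by positivity, fun h => ?_⟩
  obtain ⟨N, hN⟩ := exists_nat_gt (12 * C * h ^ 2 / ε ^ 2)
  have hN0 : (0 : ℝ) < N := lt_of_le_of_lt (by positivity) hN
  refine ⟨N, by exact_mod_cast hN0, fun F hF a m ha => ?_⟩
  have average_le : |h / N| * ‖∑ j ∈ Finset.range N, F j‖ ≤ ε / 2 := by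
    refine le_of_sq_le_sq ?_ (by positivity)
    rw [mul_pow, sq_abs]
    calc (h / N) ^ 2 * ‖∑ j ∈ Finset.range N, F j‖ ^ 2 ≤ (h / N) ^ 2 * (3 * C * N) := by
          gcongr
          exact norm_sum_range_sq_le hF N
      _ = 12 * C * h ^ 2 / 4 / N := by field_simp; ring
      _ ≤ (ε / 2) ^ 2 := by
          rw [div_lt_iff₀ (by positivity)] at hN
          rw [div_le_iff₀ hN0]
          nlinarith
  have term_le : ‖a‖ * ‖F m‖ ≤ ε / 2 := by
    have norm_le : ‖F m‖ ≤ √C := Real.le_sqrt_of_sq_le (norm_sq_le_of_norm_inner_le hF m)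
    calc ‖a‖ * ‖F m‖ ≤ ε / (2 * (√C + 1)) * (√C + 1) := by gcongr; linarith
      _ = ε / 2 := by field_simp
  calc _ ≤ ‖((h / N : ℝ) : 𝕜) • ∑ j ∈ Finset.range N, F j‖ + ‖a • F m‖ := norm_add_le _ _
    _ = |h / N| * ‖∑ j ∈ Finset.range N, F j‖ + ‖a‖ * ‖F m‖ := by
        rw [norm_smul, norm_smul, RCLike.norm_ofReal]
    _ ≤ ε := by linarith

end Hilbert

section Heights

/-- Two heights `h < h + a` whose rotation frequencies under the nonlinear flow of exponent `σ`
differ by a small amount (at most `1 / K`) that is nevertheless large (at least `K`) once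
multiplied by the height. -/
structure HasPhaseGap (σ K h a : ℝ) : Prop where
  height_pos : 0 < h
  step_pos : 0 < a
  step_le_one : a ≤ 1
  gap_le : (h + a) ^ (2 * σ) - h ^ (2 * σ) ≤ 1 / K
  le_height_mul_gap : K ≤ h * ((h + a) ^ (2 * σ) - h ^ (2 * σ))

theorem HasPhaseGap.mono {σ K L h a : ℝ} (H : HasPhaseGap σ L h a) (hK : 0 < K) (hKL : K ≤ L) :
    HasPhaseGap σ K h a where
  height_pos := H.height_pos
  step_pos := H.step_pos
  step_le_one := H.step_le_one
  gap_le := H.gap_le.trans (one_div_le_one_div_of_le hK hKL)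
  le_height_mul_gap := hKL.trans H.le_height_mul_gap

theorem rpow_add_sub_rpow_ge {p h ε : ℝ} (hp : 0 < p) (hε : 0 < ε) (hεh : ε ≤ h) :
    p * ε * h ^ p / (2 * h) ≤ (h + ε) ^ p - h ^ p := by
  have h0 : 0 < h := hε.trans_le hεh
  obtain ⟨y, ⟨hhy, hyh⟩, hy⟩ := exists_hasDerivAt_eq_slope (fun x : ℝ => x ^ p)
    (fun x => p * x ^ (p - 1)) (lt_add_of_pos_right h hε)
    (ContinuousOn.rpow_const (by fun_prop) fun _ _ => Or.inr hp.le)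
    (fun x hx => Real.hasDerivAt_rpow_const (Or.inl (h0.trans hx.1).ne'))
  have hy0 : 0 < y := h0.trans hhy
  rw [add_sub_cancel_left, eq_div_iff hε.ne'] at hy
  calc p * ε * h ^ p / (2 * h) ≤ p * ε * y ^ p / y := by gcongr; linarith
    _ = p * y ^ (p - 1) * ε := by rw [Real.rpow_sub_one hy0.ne']; ring
    _ = (h + ε) ^ p - h ^ p := hy

theorem exists_hasPhaseGap {σ ε K : ℝ} (hσ : 0 < σ) (hε : 0 < ε) (hε1 : ε ≤ 1) (hK : 0 < K) :
    ∃ h a : ℝ, a ≤ ε ∧ HasPhaseGap σ K h a := by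
  obtain ⟨h, hh, hεh, hKh⟩ :=
    (((tendsto_rpow_atTop (y := 2 * σ) (by positivity)).eventually_ge_atTop (K / (σ * ε))).and
      ((eventually_ge_atTop ε).and (eventually_ge_atTop (K ^ 2)))).exists
  have h0 : 0 < h := hε.trans_le hεh
  have le_gap : K / h ≤ (h + ε) ^ (2 * σ) - h ^ (2 * σ) := by
    refine le_trans ?_ (rpow_add_sub_rpow_ge (by positivity) hε hεh)
    rw [div_le_iff₀ (by positivity)] at hh
    calc K / h ≤ h ^ (2 * σ) * (σ * ε) / h := by gcongr
      _ = 2 * σ * ε * h ^ (2 * σ) / (2 * h) := by field_simp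
  obtain ⟨a, ⟨ha, haε⟩, gap_eq : (h + a) ^ (2 * σ) - h ^ (2 * σ) = K / h⟩ :=
    intermediate_value_Icc hε.le (f := fun a : ℝ => (h + a) ^ (2 * σ) - h ^ (2 * σ))
      ((ContinuousOn.rpow_const (by fun_prop) fun _ _ => Or.inr (by positivity)).sub
        continuousOn_const)
      (show K / h ∈ Icc _ _ from ⟨by simp only [add_zero, sub_self]; positivity, le_gap⟩)
  refine ⟨h, a, haε, h0, ha.lt_of_ne ?_, haε.trans hε1, ?_, ?_⟩
  · rintro rfl
    rw [add_zero, sub_self] at gap_eq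
    exact (div_pos hK h0).ne gap_eq
  · rw [gap_eq, div_le_div_iff₀ h0 hK]
    nlinarith
  · rw [gap_eq, mul_div_cancel₀ K h0.ne']

end Heights

section Datum

variable {E : Type*} [NormedAddCommGroup E] [InnerProductSpace ℝ E]

/-- Two balls of radius `1 / (2M)` with centres `x₀` and `x₀ + 3 e / M`, on which `v` takes the
values `h + a` and `h`. -/
structure IsTwoLevel (e : E) (M : ℝ) (x₀ : E) (h a : ℝ) (v : E → ℝ) : Prop where
  eq_top : ∀ x, ‖M • (x - x₀)‖ < 1 / 2 → v x = h + a
  eq_base : ∀ x, ‖M • (x - x₀) - (3 : ℝ) • e‖ < 1 / 2 → v x = h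

/-- The invertible real number `2 ^ j`. -/
def twoPow (j : ℕ) : ℝˣ := Units.mk0 2 two_ne_zero ^ j

@[simp]
theorem coe_twoPow (j : ℕ) : (twoPow j : ℝ) = 2 ^ j := by simp [twoPow]

theorem norm_two_pow_smul (j : ℕ) (x : E) : ‖(2 : ℝ) ^ j • x‖ = 2 ^ j * ‖x‖ := by
  rw [norm_smul, Real.norm_of_nonneg (by positivity)]

theorem four_le_norm_sub_of_ne {e : E} (he : ‖e‖ = 1) {k l : ℕ} (hkl : k ≠ l) :
    4 ≤ ‖(4 * k : ℝ) • e - (4 * l : ℝ) • e‖ := by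
  have one_le_abs : (1 : ℝ) ≤ |(k : ℝ) - l| := by
    have : (1 : ℤ) ≤ |(k : ℤ) - l| := Int.one_le_abs (by omega)
    exact_mod_cast this
  rw [← sub_smul, norm_smul, he, mul_one, ← mul_sub, norm_mul]
  simpa using one_le_abs

variable (E) in
/-- A smooth bump function equal to `1` on the ball of radius `1/2` and supported in the unit
ball; the building block of the initial datum. -/
def cutoff : ContDiffBump (0 : E) where
  rIn := 1 / 2
  rOut := 1
  rIn_pos := by norm_num
  rIn_lt_rOut := by norm_num

/-- A logarithmic average of dilated cutoffs, of height `h` at `x₀`, on top of which sits a bump of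
height `a` at the finer scale `2 ^ (-(N + 3))`. -/
def block (h a : ℝ) (N : ℕ) (x₀ x : E) : ℝ :=
  (h / N) * ∑ j ∈ Finset.range N, cutoff E ((2 : ℝ) ^ j • (x - x₀)) +
    a * cutoff E ((2 : ℝ) ^ (N + 3) • (x - x₀))

/-- Blocks placed at the points `4 k e`, far enough apart to have disjoint supports. -/
def superposition (e : E) (h a : ℕ → ℝ) (N : ℕ → ℕ) (x : E) : ℝ :=
  ∑ᶠ k : ℕ, block (h k) (a k) (N k) ((4 * k : ℝ) • e) x

variable [FiniteDimensional ℝ E]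

theorem cutoff_eq_one {x : E} (hx : ‖x‖ ≤ 1 / 2) : cutoff E x = 1 :=
  (cutoff E).one_of_mem_closedBall (by simpa [cutoff] using hx)

theorem cutoff_eq_zero {x : E} (hx : 1 ≤ ‖x‖) : cutoff E x = 0 :=
  (cutoff E).zero_of_le_dist (by simpa [cutoff] using hx)

theorem continuous_block (h a : ℝ) (N : ℕ) (x₀ : E) : Continuous (block h a N x₀) := by
  have := (cutoff E).continuous
  unfold block
  fun_prop

theorem block_eq_zero (h a : ℝ) (N : ℕ) {x₀ x : E} (hx : 1 ≤ ‖x - x₀‖) :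
    block h a N x₀ x = 0 := by
  have cutoff_zero : ∀ j : ℕ, cutoff E ((2 : ℝ) ^ j • (x - x₀)) = 0 := fun j => by
    refine cutoff_eq_zero ?_
    rw [norm_two_pow_smul]
    exact one_le_mul_of_one_le_of_one_le (one_le_pow₀ (by norm_num)) hx
  simp [block, cutoff_zero]

theorem block_of_norm_le (h a : ℝ) {N : ℕ} (hN : 0 < N) {x₀ x : E}
    (hx : ‖(2 : ℝ) ^ (N + 3) • (x - x₀)‖ ≤ 4) :
    block h a N x₀ x = h + a * cutoff E ((2 : ℝ) ^ (N + 3) • (x - x₀)) := by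
  have cutoff_one : ∀ j ∈ Finset.range N, cutoff E ((2 : ℝ) ^ j • (x - x₀)) = 1 := fun j hj => by
    refine cutoff_eq_one ?_
    have pow_le : (2 : ℝ) ^ j ≤ 2 ^ N :=
      pow_le_pow_right₀ (by norm_num) (Finset.mem_range.1 hj).le
    rw [norm_two_pow_smul] at hx ⊢
    rw [pow_add] at hx
    nlinarith [mul_le_mul_of_nonneg_right pow_le (norm_nonneg (x - x₀))]
  rw [block, Finset.sum_congr rfl cutoff_one]
  have hN' : (N : ℝ) ≠ 0 := by positivity
  simp [hN']

theorem locallyFinite_support_block {e : E} (he : ‖e‖ = 1) (h a : ℕ → ℝ) (N : ℕ → ℕ) :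
    LocallyFinite fun k : ℕ => Function.support (block (h k) (a k) (N k) ((4 * k : ℝ) • e)) := by
  intro x
  refine ⟨Metric.ball x 1, Metric.ball_mem_nhds x one_pos,
    (finite_le_nat ⌈‖x‖ + 2⌉₊).subset ?_⟩
  rintro k ⟨y, hy, hyx⟩
  have near_centre : ‖y - (4 * k : ℝ) • e‖ < 1 := by
    by_contra! hfar
    exact hy (block_eq_zero _ _ _ hfar)
  have norm_centre : ‖(4 * k : ℝ) • e‖ = 4 * k := by
    rw [norm_smul, he, mul_one, Real.norm_of_nonneg (by positivity)]
  have norm_centre_le := norm_sub_norm_le ((4 * k : ℝ) • e) y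
  have norm_y_le := norm_sub_norm_le y x
  rw [norm_sub_rev, norm_centre] at norm_centre_le
  rw [Metric.mem_ball, dist_eq_norm] at hyx
  have : (k : ℝ) ≤ ⌈‖x‖ + 2⌉₊ := by
    linarith [Nat.le_ceil (‖x‖ + 2), (Nat.cast_nonneg k : (0 : ℝ) ≤ k)]
  exact_mod_cast this

theorem continuous_superposition {e : E} (he : ‖e‖ = 1) (h a : ℕ → ℝ) (N : ℕ → ℕ) :
    Continuous (superposition e h a N) :=
  continuous_finsum (fun _ => continuous_block _ _ _ _) (locallyFinite_support_block he h a N)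

theorem superposition_of_norm_le {e : E} (he : ‖e‖ = 1) (h a : ℕ → ℝ) {N : ℕ → ℕ} {k : ℕ}
    (hN : 0 < N k) {x : E} (hx : ‖(2 : ℝ) ^ (N k + 3) • (x - (4 * k : ℝ) • e)‖ ≤ 4) :
    superposition e h a N x =
      h k + a k * cutoff E ((2 : ℝ) ^ (N k + 3) • (x - (4 * k : ℝ) • e)) := by
  rw [← block_of_norm_le (h k) (a k) hN hx]
  refine finsum_eq_single _ k fun l hl => block_eq_zero _ _ _ ?_
  have near_centre : ‖x - (4 * k : ℝ) • e‖ ≤ 1 := by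
    have : (2 : ℝ) ^ 3 ≤ 2 ^ (N k + 3) := pow_le_pow_right₀ (by norm_num) (by omega)
    rw [norm_two_pow_smul] at hx
    nlinarith [norm_nonneg (x - (4 * k : ℝ) • e)]
  have triangle := norm_sub_le_norm_sub_add_norm_sub ((4 * l : ℝ) • e) x ((4 * k : ℝ) • e)
  rw [norm_sub_rev ((4 * l : ℝ) • e) x] at triangle
  linarith [four_le_norm_sub_of_ne he hl]

theorem isTwoLevel_superposition {e : E} (he : ‖e‖ = 1) (h a : ℕ → ℝ) {N : ℕ → ℕ} {k : ℕ}
    (hN : 0 < N k) :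
    IsTwoLevel e (2 ^ (N k + 3)) ((4 * k : ℝ) • e) (h k) (a k) (superposition e h a N) where
  eq_top x hx := by
    rw [superposition_of_norm_le he h a hN (by linarith), cutoff_eq_one hx.le, mul_one]
  eq_base x hx := by
    have norm_three : ‖(3 : ℝ) • e‖ = 3 := by rw [norm_smul, he]; norm_num
    have upper := norm_sub_norm_le ((2 : ℝ) ^ (N k + 3) • (x - (4 * k : ℝ) • e)) ((3 : ℝ) • e)
    have lower := norm_sub_norm_le ((3 : ℝ) • e) ((2 : ℝ) ^ (N k + 3) • (x - (4 * k : ℝ) • e))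
    rw [norm_sub_rev] at lower
    rw [superposition_of_norm_le he h a hN (by linarith), cutoff_eq_zero (by linarith), mul_zero,
      add_zero]

theorem tsum_integral_mul_eq_integral_mul_finsum {X ι : Type*} [TopologicalSpace X]
    [MeasurableSpace X] [OpensMeasurableSpace X] {μ : Measure X} [IsFiniteMeasureOnCompacts μ]
    {g : ι → X → ℝ} (hg : ∀ i, Continuous (g i)) (hfin : LocallyFinite fun i => (g i).support)
    {χ : X → ℂ} (hχ : Continuous χ) (hχc : HasCompactSupport χ) :
    ∑' i, ∫ x, χ x * g i x ∂μ = ∫ x, χ x * ((∑ᶠ i, g i x : ℝ) : ℂ) ∂μ := by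
  have finite_meet := hfin.finite_nonempty_inter_compact hχc.isCompact
  have eq_zero_of_notMem : ∀ i ∉ finite_meet.toFinset, ∀ x, χ x * g i x = 0 := by
    intro i hi x
    by_contra! hne
    exact hi (finite_meet.mem_toFinset.2 ⟨x, fun h0 => hne (by simp [h0]),
      subset_tsupport χ (left_ne_zero_of_mul hne)⟩)
  rw [tsum_eq_sum (s := finite_meet.toFinset) fun i hi => by simp [eq_zero_of_notMem i hi],
    ← integral_finsetSum]
  · congr 1 with x
    by_cases hx : χ x = 0
    · simp [hx]
    rw [finsum_eq_sum_of_support_subset (s := finite_meet.toFinset), Complex.ofReal_sum,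
      Finset.mul_sum]
    intro i hi
    by_contra hne
    simpa [hx, Function.mem_support.1 hi] using eq_zero_of_notMem i hne x
  · intro i _
    have := hg i
    exact Continuous.integrable_of_hasCompactSupport (by fun_prop) hχc.mul_right

/-- A smooth compactly supported real function as a complex Schwartz function. -/
def realToSchwartz (f : E → ℝ) (hf : ContDiff ℝ ∞ f) (hfc : HasCompactSupport f) : 𝓢(E, ℂ) :=
  HasCompactSupport.toSchwartzMap (f := fun x => ((f x : ℝ) : ℂ))
    (hfc.comp_left (g := fun r : ℝ => (r : ℂ)) Complex.ofReal_zero)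
    (Complex.ofRealCLM.contDiff.comp hf)

variable (E) in
/-- The function `cutoff E` as a complex Schwartz function. -/
def cutoffSchwartz : 𝓢(E, ℂ) :=
  realToSchwartz (cutoff E) (cutoff E).contDiff (cutoff E).hasCompactSupport

/-- The function `block h a N x₀` as a complex Schwartz function. -/
def blockSchwartz (h a : ℝ) (N : ℕ) (x₀ : E) : 𝓢(E, ℂ) :=
  (h / N) • ∑ j ∈ Finset.range N, dilate (twoPow j) x₀ (cutoffSchwartz E) +
    a • dilate (twoPow (N + 3)) x₀ (cutoffSchwartz E)

theorem blockSchwartz_apply (h a : ℝ) (N : ℕ) (x₀ x : E) :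
    blockSchwartz h a N x₀ x = (block h a N x₀ x : ℂ) := by
  simp only [blockSchwartz, block, _root_.add_apply, _root_.smul_apply, _root_.sum_apply,
    dilate_apply, coe_twoPow]
  push_cast
  simp only [Complex.real_smul]
  push_cast
  rfl

variable [MeasurableSpace E] [BorelSpace E]

theorem besselPotential_neg_tsum_apply {ι : Type*} {s : ℝ} {f : ι → 𝓢(E, ℂ)}
    (hf : Summable fun k => besselL2 s (f k)) (χ : 𝓢(E, ℂ)) :
    TemperedDistribution.besselPotential E ℂ (-s)
      ((∑' k, besselL2 s (f k) : Lp ℂ 2 (volume : Measure E)) : 𝓢'(E, ℂ)) χ =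
      ∑' k, ∫ x, χ x * f k x := by
  set L : Lp ℂ 2 (volume : Measure E) →L[ℂ] ℂ :=
    PointwiseConvergenceCLM.evalCLM (RingHom.id ℂ) ℂ χ ∘L
      TemperedDistribution.besselPotential E ℂ (-s) ∘L Lp.toTemperedDistributionCLM ℂ volume 2
  refine (L.map_tsum hf).trans (tsum_congr fun k => ?_)
  change TemperedDistribution.besselPotential E ℂ (-s) (besselL2 s (f k) : 𝓢'(E, ℂ)) χ = _
  rw [← besselPotential_coe, TemperedDistribution.besselPotential_besselPotential_apply,
    add_neg_cancel, TemperedDistribution.besselPotential_zero]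
  simp only [ContinuousLinearMap.id_apply, SchwartzMap.toTemperedDistributionCLM_apply_apply,
    smul_eq_mul]

theorem exists_norm_besselL2_log_average_le [Nontrivial E] (φ : 𝓢(E, ℂ)) {ε : ℝ} (hε : 0 < ε) :
    ∃ η > 0, ∀ h : ℝ, ∃ N : ℕ, 0 < N ∧ ∀ a : ℝ, |a| ≤ η → ∀ x₀ : E,
      ‖besselL2 ((finrank ℝ E : ℝ) / 2) ((h / N) • ∑ j ∈ Finset.range N, dilate (twoPow j) x₀ φ +
        a • dilate (twoPow (N + 3)) x₀ φ)‖ ≤ ε := by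
  obtain ⟨C, hC, inner_le⟩ := exists_norm_inner_besselL2_dilate_le φ
  obtain ⟨η, hη, average_le⟩ := exists_norm_average_add_smul_le
    (𝕜 := ℂ) (H := Lp ℂ 2 (volume : Measure E)) hC hε
  refine ⟨η, hη, fun h => ?_⟩
  obtain ⟨N, hN, norm_le⟩ := average_le h
  refine ⟨N, hN, fun a ha x₀ => ?_⟩
  set F : ℕ → Lp ℂ 2 (volume : Measure E) := fun j =>
    besselL2 ((finrank ℝ E : ℝ) / 2) (dilate (twoPow j) x₀ φ)
  have almost_orthogonal : ∀ i j, i ≤ j → ‖inner ℂ (F i) (F j)‖ ≤ C * ((2 : ℝ) ^ i / 2 ^ j) := by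
    intro i j hij
    have pow_le : (2 : ℝ) ^ i ≤ 2 ^ j := pow_le_pow_right₀ (by norm_num) hij
    refine (inner_le (twoPow i) (twoPow j) (by simpa using one_le_pow₀ (by norm_num))
      (by simpa using one_le_pow₀ (by norm_num)) x₀).trans ?_
    gcongr
    simp only [coe_twoPow]
    exact pow_le_of_le_one (by positivity) ((div_le_one (by positivity)).2 pow_le) finrank_pos.ne'
  have norm_average_le := norm_le F almost_orthogonal (a : ℂ) (N + 3) (by simpa using ha)
  rw [map_add, ContinuousLinearMap.map_smul_of_tower, ContinuousLinearMap.map_smul_of_tower,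
    map_sum]
  exact norm_average_le

theorem exists_continuous_unbounded_phase [Nontrivial E] {e : E} (he : ‖e‖ = 1) {σ δ : ℝ}
    (hσ : 0 < σ) (hδ : 0 < δ) :
    ∃ v : E → ℝ, Continuous v ∧
      (∃ F : Lp ℂ 2 (volume : Measure E), ‖F‖ ≤ δ ∧ ∀ χ : 𝓢(E, ℂ), HasCompactSupport χ →
        TemperedDistribution.besselPotential E ℂ (-((finrank ℝ E : ℝ) / 2)) (F : 𝓢'(E, ℂ)) χ =
          ∫ x, χ x * v x) ∧
      ∀ K : ℝ, 0 < K → ∃ (M : ℝˣ) (x₀ : E) (h a : ℝ), (0 : ℝ) < M ∧ HasPhaseGap σ K h a ∧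
        IsTwoLevel e M x₀ h a v := by
  choose η hη average_le using fun k : ℕ => exists_norm_besselL2_log_average_le
    (cutoffSchwartz E) (show 0 < δ / 2 / 2 ^ k by positivity)
  choose h a haη gap using fun k : ℕ =>
    exists_hasPhaseGap hσ (lt_min (hη k) one_pos) (min_le_right _ _)
      (show (0 : ℝ) < k + 1 by positivity)
  choose N hN norm_le using fun k => average_le k (h k)
  have norm_block_le : ∀ k : ℕ, ‖besselL2 ((finrank ℝ E : ℝ) / 2)
      (blockSchwartz (h k) (a k) (N k) ((4 * k : ℝ) • e))‖ ≤ δ / 2 / 2 ^ k := fun k =>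
    norm_le k (a k)
      (by rw [abs_of_pos (gap k).step_pos]; exact (haη k).trans (min_le_left _ _)) _
  have hgeom := hasSum_geometric_two' δ
  refine ⟨superposition e h a N, continuous_superposition he h a N,
    ⟨_, tsum_of_norm_bounded hgeom norm_block_le, fun χ hχ => ?_⟩, fun K hK => ?_⟩
  · rw [besselPotential_neg_tsum_apply (.of_norm_bounded hgeom.summable norm_block_le)]
    simp only [blockSchwartz_apply]
    exact tsum_integral_mul_eq_integral_mul_finsum (fun k => continuous_block _ _ _ _)
      (locallyFinite_support_block he h a N) χ.continuous hχ
  · obtain ⟨k, hk⟩ := exists_nat_gt K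
    exact ⟨twoPow (N k + 3), (4 * k : ℝ) • e, h k, a k, by simp, (gap k).mono hK (by linarith),
      by simpa using isTwoLevel_superposition he h a (hN k)⟩

end Datum

/-! ### The phase flow and its loss of regularity -/

section Flow

/-- The oscillating factor `e^{i a t}`. -/
def wave (a t : ℝ) : ℂ := Complex.exp (Complex.I * ((a * t : ℝ) : ℂ))

theorem norm_wave (a t : ℝ) : ‖wave a t‖ = 1 := Complex.norm_exp_I_mul_ofReal _

@[simp]
theorem wave_zero_right (a : ℝ) : wave a 0 = 1 := by simp [wave]

theorem wave_add (a b t : ℝ) : wave (a + b) t = wave a t * wave b t := by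
  rw [wave, wave, wave, ← Complex.exp_add, ← mul_add, add_mul, Complex.ofReal_add]

theorem wave_neg_mul_wave (a t : ℝ) : wave (-a) t * wave a t = 1 := by
  rw [← wave_add, neg_add_cancel]
  simp [wave]

theorem two_div_pi_mul_abs_le_norm_wave_sub_one {a t : ℝ} (h : |a * t| ≤ Real.pi) :
    2 / Real.pi * |a * t| ≤ ‖wave a t - 1‖ := by
  have le_sin := Real.mul_abs_le_abs_sin (x := a * t / 2) (by rw [abs_div, abs_two]; linarith)
  rw [abs_div, abs_two] at le_sin
  rw [wave, Complex.norm_exp_I_mul_ofReal_sub_one, norm_mul, Real.norm_two, Real.norm_eq_abs]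
  linarith

/-- The value at time `t` of the solution of `i w' = lam |w|^{2σ} w`, `w(0) = z`. -/
def flow (lam σ t : ℝ) (z : ℂ) : ℂ := wave (-(lam * ‖z‖ ^ (2 * σ))) t * z

theorem norm_flow (lam σ t : ℝ) (z : ℂ) : ‖flow lam σ t z‖ = ‖z‖ := by
  rw [flow, norm_mul, norm_wave, one_mul]

theorem flow_zero (lam σ : ℝ) (z : ℂ) : flow lam σ 0 z = z := by simp [flow]

theorem flow_add_sub_flow (lam σ t : ℝ) {h a : ℝ} (hh : 0 ≤ h) (ha : 0 ≤ a) :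
    flow lam σ t ((h + a : ℝ) : ℂ) - flow lam σ t (h : ℂ) =
      h * wave (-(lam * h ^ (2 * σ))) t *
          (wave (-(lam * ((h + a) ^ (2 * σ) - h ^ (2 * σ)))) t - 1) +
        a * wave (-(lam * (h + a) ^ (2 * σ))) t := by
  rw [flow, flow, Complex.norm_of_nonneg hh, Complex.norm_of_nonneg (add_nonneg hh ha),
    show -(lam * (h + a) ^ (2 * σ)) =
      -(lam * h ^ (2 * σ)) + -(lam * ((h + a) ^ (2 * σ) - h ^ (2 * σ))) by ring, wave_add]
  push_cast
  ring

theorem le_norm_flow_sub_flow {lam σ t h a K : ℝ} (hK : 0 < K) (H : HasPhaseGap σ K h a)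
    (ht : |lam * t| ≤ Real.pi * K) :
    2 / Real.pi * |lam * t| * K - 1 ≤
      ‖flow lam σ t ((h + a : ℝ) : ℂ) - flow lam σ t (h : ℂ)‖ := by
  obtain ⟨hh, ha, ha1, gap_le, le_gap⟩ := H
  set gap := (h + a) ^ (2 * σ) - h ^ (2 * σ)
  have gap_pos : 0 < gap := pos_of_mul_pos_right (hK.trans_le le_gap) hh.le
  have abs_angle : |-(lam * gap) * t| = |lam * t| * gap := by
    rw [neg_mul, abs_neg, mul_right_comm, abs_mul, abs_of_pos gap_pos]
  have angle_le : |-(lam * gap) * t| ≤ Real.pi :=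
    calc _ = |lam * t| * gap := abs_angle
      _ ≤ (Real.pi * K) * (1 / K) := by gcongr
      _ = Real.pi := by field_simp
  have sub_eq : flow lam σ t ((h + a : ℝ) : ℂ) - flow lam σ t (h : ℂ) =
      h * wave (-(lam * h ^ (2 * σ))) t * (wave (-(lam * gap)) t - 1) +
        a * wave (-(lam * (h + a) ^ (2 * σ))) t := flow_add_sub_flow lam σ t hh.le ha.le
  rw [sub_eq]
  calc 2 / Real.pi * |lam * t| * K - 1 ≤ 2 / Real.pi * |lam * t| * (h * gap) - a := by gcongr
    _ = h * (2 / Real.pi * |-(lam * gap) * t|) - a := by rw [abs_angle]; ring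
    _ ≤ h * ‖wave (-(lam * gap)) t - 1‖ - a := by
        gcongr
        exact two_div_pi_mul_abs_le_norm_wave_sub_one angle_le
    _ ≤ _ := by
        refine le_trans (le_of_eq ?_) (norm_sub_le_norm_add _ _)
        rw [norm_mul, norm_mul, norm_mul, norm_wave, norm_wave, Complex.norm_of_nonneg hh.le,
          Complex.norm_of_nonneg ha.le, mul_one, mul_one]

end Flow

section Dipole

variable {E : Type*} [NormedAddCommGroup E] [InnerProductSpace ℝ E] [FiniteDimensional ℝ E]
  [MeasurableSpace E] [BorelSpace E]

variable (E) in
/-- A smooth function of integral one supported in the ball of radius `1 / 2`. -/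
def mollifier : E → ℝ :=
  (⟨1 / 4, 1 / 2, by norm_num, by norm_num⟩ : ContDiffBump (0 : E)).normed volume

theorem contDiff_mollifier : ContDiff ℝ ∞ (mollifier E) := ContDiffBump.contDiff_normed _

theorem hasCompactSupport_mollifier : HasCompactSupport (mollifier E) :=
  ContDiffBump.hasCompactSupport_normed _

theorem mollifier_eq_zero {x : E} (hx : 1 / 2 ≤ ‖x‖) : mollifier E x = 0 := by
  rw [← Function.notMem_support, mollifier, ContDiffBump.support_normed_eq, mem_ball_zero_iff]
  exact not_lt.2 hx

/-- The mollifier concentrated at scale `M⁻¹` near the point `x₀ + M⁻¹ e`. -/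
def concentratedMollifier (M : ℝˣ) (x₀ e x : E) : ℝ :=
  (M : ℝ) ^ finrank ℝ E * mollifier E ((M : ℝ) • (x - x₀) - e)

theorem contDiff_concentratedMollifier (M : ℝˣ) (x₀ e : E) :
    ContDiff ℝ ∞ (concentratedMollifier M x₀ e) := by
  have := contDiff_mollifier (E := E)
  unfold concentratedMollifier
  fun_prop

theorem hasCompactSupport_concentratedMollifier (M : ℝˣ) (x₀ e : E) :
    HasCompactSupport (concentratedMollifier M x₀ e) :=
  (hasCompactSupport_mollifier.comp_homeomorph ((Homeomorph.subRight x₀).trans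
    ((Homeomorph.smulOfNeZero (M : ℝ) M.ne_zero).trans (Homeomorph.subRight e)))).mul_left

theorem integrable_concentratedMollifier (M : ℝˣ) (x₀ e : E) :
    Integrable (concentratedMollifier M x₀ e) :=
  (contDiff_concentratedMollifier M x₀ e).continuous.integrable_of_hasCompactSupport
    (hasCompactSupport_concentratedMollifier M x₀ e)

theorem integral_concentratedMollifier {M : ℝˣ} (hM : (0 : ℝ) < M) (x₀ e : E) :
    ∫ x, concentratedMollifier M x₀ e x = 1 := by
  simp only [concentratedMollifier]
  rw [integral_const_mul,
    integral_sub_right_eq_self (fun x => mollifier E ((M : ℝ) • x - e)) x₀,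
    Measure.integral_comp_smul volume (fun x => mollifier E (x - e)),
    integral_sub_right_eq_self (mollifier E) e, mollifier, ContDiffBump.integral_normed]
  simp [abs_of_pos hM]

theorem concentratedMollifier_mul_eq {M : ℝˣ} {x₀ e : E} {U : E → ℂ} {A : ℂ}
    (hU : ∀ x, ‖(M : ℝ) • (x - x₀) - e‖ < 1 / 2 → U x = A) (x : E) :
    (concentratedMollifier M x₀ e x : ℂ) * U x = concentratedMollifier M x₀ e x * A := by
  rcases lt_or_ge ‖(M : ℝ) • (x - x₀) - e‖ (1 / 2) with h | h
  · rw [hU x h]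
  · simp [concentratedMollifier, mollifier_eq_zero h]

/-- The difference of two bumps of mass one concentrated at scale `M⁻¹`, near `x₀` and near
`x₀ + M⁻¹ e`. -/
def dipole (e : E) (M : ℝˣ) (x₀ x : E) : ℝ :=
  concentratedMollifier M x₀ 0 x - concentratedMollifier M x₀ e x

theorem contDiff_dipole (e : E) (M : ℝˣ) (x₀ : E) : ContDiff ℝ ∞ (dipole e M x₀) :=
  (contDiff_concentratedMollifier M x₀ 0).sub (contDiff_concentratedMollifier M x₀ e)

theorem hasCompactSupport_dipole (e : E) (M : ℝˣ) (x₀ : E) :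
    HasCompactSupport (dipole e M x₀) :=
  (hasCompactSupport_concentratedMollifier M x₀ 0).sub
    (hasCompactSupport_concentratedMollifier M x₀ e)

theorem integral_dipole_mul {M : ℝˣ} (hM : (0 : ℝ) < M) {x₀ e : E} {U : E → ℂ} {A B : ℂ}
    (hA : ∀ x, ‖(M : ℝ) • (x - x₀)‖ < 1 / 2 → U x = A)
    (hB : ∀ x, ‖(M : ℝ) • (x - x₀) - e‖ < 1 / 2 → U x = B) :
    ∫ x, (dipole e M x₀ x : ℂ) * U x = A - B := by
  simp only [dipole, Complex.ofReal_sub, sub_mul]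
  simp only [concentratedMollifier_mul_eq hB,
    concentratedMollifier_mul_eq (e := 0) fun x hx => hA x (by rwa [sub_zero] at hx)]
  rw [integral_sub ((integrable_concentratedMollifier M x₀ 0).ofReal.mul_const _)
      ((integrable_concentratedMollifier M x₀ e).ofReal.mul_const _),
    integral_mul_const, integral_mul_const, integral_complex_ofReal, integral_complex_ofReal,
    integral_concentratedMollifier hM, integral_concentratedMollifier hM, Complex.ofReal_one,
    one_mul, one_mul]

variable (E) in
/-- The function `mollifier E` as a complex Schwartz function. -/
def mollifierSchwartz : 𝓢(E, ℂ) :=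
  realToSchwartz (mollifier E) contDiff_mollifier hasCompactSupport_mollifier

theorem realToSchwartz_dipole (e : E) (M : ℝˣ) (x₀ : E) :
    realToSchwartz (dipole e M x₀) (contDiff_dipole e M x₀) (hasCompactSupport_dipole e M x₀) =
      (M : ℝ) ^ finrank ℝ E •
        dilate M x₀ (mollifierSchwartz E - dilate 1 e (mollifierSchwartz E)) := by
  ext x
  simp only [_root_.smul_apply, _root_.sub_apply, dilate_apply, Complex.real_smul, Units.val_one,
    one_smul]
  change ((dipole e M x₀ x : ℝ) : ℂ) = _ * ((mollifier E _ : ℂ) - mollifier E _)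
  simp only [dipole, concentratedMollifier, sub_zero]
  push_cast
  ring

-- Dipoles have mean zero, which is why they stay bounded in `H^{-n/2}` under concentration.
theorem exists_norm_apply_dipole_le [Nontrivial E] (e : E) {T : 𝓢'(E, ℂ)}
    (hT : TemperedDistribution.MemSobolev ((finrank ℝ E : ℝ) / 2) 2 T) :
    ∃ C : ℝ, ∀ (M : ℝˣ) (x₀ : E), ‖T (realToSchwartz (dipole e M x₀) (contDiff_dipole e M x₀)
      (hasCompactSupport_dipole e M x₀))‖ ≤ C := by
  obtain ⟨A, fourier_le⟩ := exists_norm_fourier_sub_translate_le (mollifierSchwartz E) e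
  simpa only [realToSchwartz_dipole] using exists_norm_apply_dilate_le fourier_le hT

end Dipole

theorem hasCompactSupport_testToSchwartz (φ : 𝓓((⊤ : Opens (Space d)), ℝ)) :
    HasCompactSupport (testToSchwartz φ) :=
  φ.hasCompactSupport.comp_left (g := fun r : ℝ => (r : ℂ)) Complex.ofReal_zero

theorem memH_of_restrictsTo_besselPotential_neg {s : ℝ} {F : Lp ℂ 2 (volume : Measure (Space d))}
    {u : Distr d}
    (hu : RestrictsTo (TemperedDistribution.besselPotential (Space d) ℂ (-s)
      (F : 𝓢'(Space d, ℂ))) u) : MemH s u :=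
  ⟨_, hu, F, (TemperedDistribution.besselPotential_neg_apply_eq_iff _ _ _).1 rfl⟩

theorem normH_le_of_restrictsTo_besselPotential_neg {s : ℝ}
    {F : Lp ℂ 2 (volume : Measure (Space d))} {u : Distr d}
    (hu : RestrictsTo (TemperedDistribution.besselPotential (Space d) ℂ (-s)
      (F : 𝓢'(Space d, ℂ))) u) : normH s u ≤ ‖F‖ₑ :=
  iInf₂_le_of_le _ hu <| iInf₂_le F
    ((TemperedDistribution.besselPotential_neg_apply_eq_iff _ _ _).1 rfl)

theorem not_memH_flow [NeZero d] {lam σ t : ℝ} (hlam : lam ≠ 0) (ht : t ≠ 0) {e : Space d}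
    {v : Space d → ℝ}
    (hv : ∀ K : ℝ, 0 < K → ∃ (M : ℝˣ) (x₀ : Space d) (h a : ℝ), (0 : ℝ) < M ∧
      HasPhaseGap σ K h a ∧ IsTwoLevel e M x₀ h a v)
    {c : Space d} {κ : ℂ} (hκ : ‖κ‖ = 1) {u : Distr d}
    (hu : ∀ φ : 𝓓((⊤ : Opens (Space d)), ℝ),
      u φ = ∫ x, ((φ x : ℝ) : ℂ) * (κ * flow lam σ t (v (x + c)))) :
    ¬ MemH ((d : ℝ) / 2) u := by
  rintro ⟨T, hTu, hT⟩
  obtain ⟨C, apply_dipole_le⟩ := exists_norm_apply_dipole_le ((3 : ℝ) • e) (T := T)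
    (by rwa [finrank_euclideanSpace_fin])
  have : 0 < |lam * t| := abs_pos.2 (mul_ne_zero hlam ht)
  obtain ⟨K, hK, angle_le, jump_gt⟩ : ∃ K : ℝ, 0 < K ∧ |lam * t| ≤ Real.pi * K ∧
      C + 1 < 2 / Real.pi * |lam * t| * K :=
    ((eventually_gt_atTop 0).and (((tendsto_id.const_mul_atTop Real.pi_pos).eventually_ge_atTop
      _).and ((tendsto_id.const_mul_atTop (by positivity)).eventually_gt_atTop _))).exists
  obtain ⟨M, x₀, h, a, hM, hgap, htwo⟩ := hv K hK
  have jump_le := le_norm_flow_sub_flow (lam := lam) hK hgap angle_le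
  set φ : 𝓓((⊤ : Opens (Space d)), ℝ) := ⟨dipole ((3 : ℝ) • e) M (x₀ - c),
    contDiff_dipole _ _ _, hasCompactSupport_dipole _ _ _, fun _ _ => trivial⟩
  have apply_dipole : T (testToSchwartz φ) =
      κ * flow lam σ t ((h + a : ℝ) : ℂ) - κ * flow lam σ t (h : ℂ) := by
    rw [← hTu, hu]
    refine integral_dipole_mul hM (fun x hx => ?_) (fun x hx => ?_)
    · rw [htwo.eq_top _ (by rwa [← sub_sub_eq_add_sub])]
    · rw [htwo.eq_base _ (by rwa [← sub_sub_eq_add_sub])]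
  have norm_apply_le : ‖T (testToSchwartz φ)‖ ≤ C := apply_dipole_le M (x₀ - c)
  rw [apply_dipole, ← mul_sub, norm_mul, hκ, one_mul] at norm_apply_le
  linarith

/-! ### Continuous curves of distributions -/

section Curve

theorem continuous_integral_restrict {X Y : Type*} [TopologicalSpace X] [LocallyCompactSpace X]
    [FirstCountableTopology X] [TopologicalSpace Y] [MeasurableSpace Y] [OpensMeasurableSpace Y]
    [SecondCountableTopologyEither Y ℂ] {μ : Measure Y} [IsFiniteMeasureOnCompacts μ]
    {U : X × Y → ℂ} (hU : Continuous U) {K : Set Y} (hK : IsCompact K) (hKm : MeasurableSet K) :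
    Continuous fun p : BoundedContinuousFunction Y ℝ × X =>
      ∫ y in K, ((p.1 y : ℝ) : ℂ) * U (p.2, y) ∂μ := by
  have continuous_integrand : Continuous fun q : (BoundedContinuousFunction Y ℝ × X) × Y =>
      ((q.1.1 q.2 : ℝ) : ℂ) * U (q.1.2, q.2) :=
    (Complex.continuous_ofReal.comp (continuous_fst.fst.eval continuous_snd)).mul
      (hU.comp (by fun_prop))
  rw [continuous_iff_continuousAt]
  rintro ⟨f₀, t₀⟩
  obtain ⟨V, hV, hVt⟩ := exists_compact_mem_nhds t₀
  obtain ⟨C, hC⟩ := (hV.prod hK).exists_bound_of_continuousOn hU.continuousOn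
  have norm_near : ∀ᶠ p : BoundedContinuousFunction Y ℝ × X in 𝓝 (f₀, t₀), ‖p.1‖ < ‖f₀‖ + 1 :=
    (continuous_fst.norm.tendsto (f₀, t₀)).eventually_lt_const (by simp)
  refine continuousAt_of_dominated (bound := fun _ => (‖f₀‖ + 1) * C)
    (.of_forall fun p => (continuous_integrand.comp
      (Continuous.prodMk_right p)).aestronglyMeasurable) ?_
    (integrableOn_const hK.measure_ne_top)
    (.of_forall fun y => (continuous_integrand.comp (Continuous.prodMk_left y)).continuousAt)
  filter_upwards [norm_near, continuous_snd.tendsto (f₀, t₀) hVt] with p hpf hpt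
  refine (ae_restrict_iff' hKm).2 (.of_forall fun y hy => ?_)
  rw [norm_mul, Complex.norm_real]
  gcongr
  · exact (p.1.norm_coe_le_norm y).trans hpf.le
  · exact hC (p.2, y) ⟨hpt, hy⟩

theorem continuous_integral_ofSupportedIn {U : ℝ≥0 × Space d → ℂ} (hU : Continuous U)
    (K : Compacts (Space d)) (hK : (K : Set (Space d)) ⊆ (⊤ : Opens (Space d))) :
    Continuous fun p : ContDiffMapSupportedIn (Space d) ℝ ⊤ K × ℝ≥0 =>
      ∫ x, ((TestFunction.ofSupportedIn hK p.1 x : ℝ) : ℂ) * U (p.2, x) := by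
  have h := (continuous_integral_restrict (μ := volume) hU K.isCompact
    K.isCompact.measurableSet).comp
    ((ContDiffMapSupportedIn.toBoundedContinuousFunctionCLM ℝ
      (E := Space d) (F := ℝ) (n := ⊤) (K := K)).continuous.prodMap continuous_id)
  refine h.congr fun p => setIntegral_eq_integral_of_forall_compl_eq_zero fun x hx => ?_
  have : p.1 x = 0 := p.1.zero_on_compl hx
  simp [this]

theorem integrable_test_mul {μ : Measure (Space d)} {U : Space d → ℂ} (hU : LocallyIntegrable U μ)
    (φ : 𝓓((⊤ : Opens (Space d)), ℝ)) : Integrable (fun x => ((φ x : ℝ) : ℂ) * U x) μ := by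
  simpa only [Complex.real_smul] using
    hU.integrable_smul_left_of_hasCompactSupport φ.continuous φ.hasCompactSupport

/-- The pairing of a continuous function on space-time with a test function on space, as a
function of time. -/
def timePairing (U : ℝ≥0 × Space d → ℂ) (hU : Continuous U) :
    𝓓((⊤ : Opens (Space d)), ℝ) →L[ℝ] C(ℝ≥0, ℂ) :=
  TestFunction.mkCLM ℝ
    (fun φ => ⟨fun t => ∫ x, ((φ x : ℝ) : ℂ) * U (t, x),
      (continuous_integral_ofSupportedIn hU ⟨tsupport φ, φ.hasCompactSupport⟩
        (fun _ _ => trivial)).comp (Continuous.prodMk_right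
          (ContDiffMapSupportedIn.of_support_subset φ.contDiff subset_closure))⟩)
    (fun φ ψ => by
      ext t
      have hUt : LocallyIntegrable fun x => U (t, x) :=
        (hU.comp (by fun_prop)).locallyIntegrable
      change ∫ x, (((φ + ψ) x : ℝ) : ℂ) * U (t, x) = (∫ x, _) + ∫ x, _
      rw [← integral_add (integrable_test_mul hUt φ) (integrable_test_mul hUt ψ)]
      simp [add_mul])
    (fun c φ => by
      ext t
      change ∫ x, (((c • φ) x : ℝ) : ℂ) * U (t, x) = c • ∫ x, _
      rw [← integral_smul]
      simp [mul_assoc])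
    (fun K hK => ContinuousMap.continuous_of_continuous_uncurry _
      (continuous_integral_ofSupportedIn hU K hK))

/-- The curve of distributions defined by a continuous function on space-time. -/
def toDistrCurve (U : ℝ≥0 × Space d → ℂ) (hU : Continuous U) : C(ℝ≥0, Distr d) where
  toFun t := ContinuousLinearMap.toUniformConvergenceCLM (RingHom.id ℝ) ℂ {S | IsCompact S}
    (ContinuousMap.evalCLM ℝ t ∘L timePairing U hU)
  continuous_toFun := by
    rw [continuous_iff_continuousAt]
    intro t
    -- The topology on distributions is that of uniform convergence on compact sets.
    refine (UniformConvergenceCLM.tendsto_iff_tendstoUniformlyOn _ _ _).2 fun S hS u hu => ?_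
    have continuous_pairing : Continuous fun p : ℝ≥0 × 𝓓((⊤ : Opens (Space d)), ℝ) =>
        timePairing U hU p.2 p.1 := by fun_prop
    obtain ⟨V, hV, hVu⟩ := IsCompact.mem_uniformity_of_prod (s := univ) (q := t)
      (f := fun s φ => timePairing U hU φ s) hS continuous_pairing.continuousOn (mem_univ t)
      (symm_le_uniformity hu)
    rw [nhdsWithin_univ] at hV
    filter_upwards [hV] with s hs φ hφ
    exact hVu s hs φ hφ

theorem toDistrCurve_apply {U : ℝ≥0 × Space d → ℂ} (hU : Continuous U) (t : ℝ≥0)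
    (φ : 𝓓((⊤ : Opens (Space d)), ℝ)) :
    toDistrCurve U hU t φ = ∫ x, ((φ x : ℝ) : ℂ) * U (t, x) := rfl

end Curve

/-! ### Weak derivatives -/

section WeakDerivative

variable {E F : Type*} [NormedAddCommGroup E] [NormedSpace ℝ E] [NormedAddCommGroup F]
  [NormedSpace ℝ F] {𝕜 : Type*} [RCLike 𝕜] [NormedSpace 𝕜 F] {Ω : Opens E}

theorem lineDerivOp_test_apply (v : E) (φ : 𝓓(Ω, F)) (x : E) :
    (∂_{v} φ) x = fderiv ℝ φ x v := by
  rw [TestFunction.lineDerivOp_eq_lineDerivCLM (𝕜 := ℝ),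
    TestFunction.lineDerivCLM_apply_of_le (by simp),
    (φ.contDiff.differentiable (by simp)).differentiableAt.lineDeriv_eq_fderiv]

variable [MeasureSpace E]

theorem integrable_test_smul {F : Type*} [NormedAddCommGroup F] [NormedSpace 𝕜 F]
    [OpensMeasurableSpace E] (φ : 𝓓(Ω, 𝕜)) {f : E → F}
    (hf : LocallyIntegrableOn f Ω) : Integrable fun x => φ x • f x :=
  TestFunction.integrable_bilin (ContinuousLinearMap.lsmul 𝕜 𝕜) hf φ

/-- The function `f` has the weak derivative `g` in the direction `v` on `Ω`, as seen by test
functions with values in `𝕜`. It is meant for functions which are locally integrable on `Ω`. -/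
def HasWeakLineDeriv (𝕜 : Type*) [RCLike 𝕜] [NormedSpace 𝕜 F] (Ω : Opens E) (v : E)
    (f g : E → F) : Prop :=
  ∀ φ : 𝓓(Ω, 𝕜), ∫ x, (∂_{v} φ) x • f x = -∫ x, φ x • g x

theorem hasWeakLineDeriv_of_hasLineDerivAt [BorelSpace E] [FiniteDimensional ℝ E]
    [(volume : Measure E).IsAddHaarMeasure] [IsScalarTower ℝ 𝕜 F] {v : E} {f g : E → F}
    (hf : LocallyIntegrableOn f Ω) (hg : LocallyIntegrableOn g Ω)
    (hfg : ∀ x, HasLineDerivAt ℝ f (g x) x v) : HasWeakLineDeriv 𝕜 Ω v f g := by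
  intro φ
  have hasLineDerivAt_test : ∀ x, HasLineDerivAt ℝ φ ((∂_{v} φ) x) x v := fun x => by
    rw [lineDerivOp_test_apply]
    exact (φ.contDiff.differentiable (by simp) x).hasFDerivAt.hasLineDerivAt v
  refine neg_eq_iff_eq_neg.1 (Eq.symm ?_)
  exact integral_bilinear_hasLineDerivAt_right_eq_neg_left_of_integrable
    (B := ContinuousLinearMap.lsmul ℝ 𝕜) (integrable_test_smul _ hf) (integrable_test_smul _ hg)
    (integrable_test_smul _ hf) (fun x _ => hasLineDerivAt_test x) (fun x _ => hfg x)

end WeakDerivative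

/-! ### Straightening the characteristics -/

section Transport

theorem contDiff_wave (a : ℝ) : ContDiff ℝ ∞ (wave a) := by
  unfold wave
  exact (contDiff_const.mul (Complex.ofRealCLM.contDiff.comp
    (contDiff_const.mul contDiff_id))).cexp

theorem continuous_wave (a : ℝ) : Continuous (wave a) := (contDiff_wave a).continuous

theorem hasDerivAt_wave (a t : ℝ) : HasDerivAt (wave a) (wave a t * (Complex.I * a)) t := by
  have angle : HasDerivAt (fun t : ℝ => ((a * t : ℝ) : ℂ)) (a : ℂ) t := by
    simpa using ((hasDerivAt_id t).const_mul a).ofReal_comp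
  exact (angle.const_mul Complex.I).cexp

/-- The shear `(t, x) ↦ (t, x + t c)` of space-time. -/
def shear (c : Space d) : (ℝ × Space d) ≃ₜ (ℝ × Space d) where
  toFun p := (p.1, p.2 + p.1 • c)
  invFun p := (p.1, p.2 - p.1 • c)
  left_inv p := by simp
  right_inv p := by simp
  continuous_toFun := by fun_prop
  continuous_invFun := by fun_prop

theorem shear_apply (c : Space d) (p : ℝ × Space d) : shear c p = (p.1, p.2 + p.1 • c) := rfl

theorem shear_shear_neg (c : Space d) (p : ℝ × Space d) : shear (-c) (shear c p) = p := by
  simp [shear_apply]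

theorem measurePreserving_shear (c : Space d) :
    MeasurePreserving (shear c) (volume : Measure (ℝ × Space d)) volume :=
  MeasurePreserving.skew_product (f := id) (g := fun t x => x + t • c)
    (MeasurePreserving.id _) (by fun_prop)
    (.of_forall fun t => (measurePreserving_add_right volume (t • c)).map_eq)

theorem shear_preimage_spaceTime (c : Space d) :
    shear c ⁻¹' (spaceTime d : Set (ℝ × Space d)) = spaceTime d := by
  ext p
  simp [spaceTime, shear]

theorem setIntegral_comp_shear (c : Space d) (g : ℝ × Space d → ℂ) :
    ∫ p in (spaceTime d : Set (ℝ × Space d)), g (shear c p) =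
      ∫ p in (spaceTime d : Set (ℝ × Space d)), g p := by
  simpa only [shear_preimage_spaceTime] using (measurePreserving_shear c).setIntegral_preimage_emb
    (shear c).measurableEmbedding g (spaceTime d : Set (ℝ × Space d))

theorem locallyIntegrableOn_comp_shear (c : Space d) {g : ℝ × Space d → ℂ}
    (hg : LocallyIntegrableOn g (spaceTime d)) :
    LocallyIntegrableOn (fun p => g (shear c p)) (spaceTime d) := by
  rw [locallyIntegrableOn_iff (spaceTime d).isOpen.isLocallyClosed] at hg ⊢
  intro K hK hKc
  have image_subset : shear c '' K ⊆ spaceTime d := by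
    rwa [image_subset_iff, shear_preimage_spaceTime]
  have integrable_comp := ((measurePreserving_shear c).integrableOn_comp_preimage
    (shear c).measurableEmbedding).2 (hg _ image_subset (hKc.image (shear c).continuous))
  rwa [(shear c).injective.preimage_image] at integrable_comp

/-- The group `e^{itP(D)}` of the affine symbol `P(ξ) = c·ξ + a`, acting on each time slice of a
function on space-time. It turns `∂ₜ` into `∂ₜ - i P(D)`, i.e. straightens the characteristics. -/
def transport (c : Space d) (a : ℝ) (W : ℝ × Space d → ℂ) (p : ℝ × Space d) : ℂ :=
  wave a p.1 * W (shear c p)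

theorem transport_transport_neg (c : Space d) (a : ℝ) (W : ℝ × Space d → ℂ) :
    transport c a (transport (-c) (-a) W) = W := by
  ext p
  rw [transport, transport, shear_shear_neg, ← mul_assoc, mul_comm (wave a _)]
  exact (congrArg (· * W p) (wave_neg_mul_wave a p.1)).trans (one_mul _)

theorem locallyIntegrableOn_transport (c : Space d) (a : ℝ) {W : ℝ × Space d → ℂ}
    (hW : LocallyIntegrableOn W (spaceTime d)) :
    LocallyIntegrableOn (transport c a W) (spaceTime d) :=
  (locallyIntegrableOn_comp_shear c hW).continuousOn_mul
    ((continuous_wave a).comp continuous_fst).continuousOn (spaceTime d).isOpen.isLocallyClosed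

theorem nonlin_mul_of_norm_one (σ : ℝ) {w : ℂ} (hw : ‖w‖ = 1) (z : ℂ) :
    nonlin σ (w * z) = w * nonlin σ z := by
  rw [nonlin, nonlin, norm_mul, hw, one_mul]
  ring

theorem nonlin_transport (c : Space d) (a σ : ℝ) (W : ℝ × Space d → ℂ) (p : ℝ × Space d) :
    nonlin σ (transport c a W p) = transport c a (fun q => nonlin σ (W q)) p :=
  nonlin_mul_of_norm_one σ (norm_wave a p.1) _

theorem contDiff_transport (c : Space d) (a : ℝ) {W : ℝ × Space d → ℂ} (hW : ContDiff ℝ ∞ W) :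
    ContDiff ℝ ∞ (transport c a W) :=
  ((contDiff_wave a).comp contDiff_fst).mul
    (hW.comp (g := W) (f := fun p : ℝ × Space d => (p.1, p.2 + p.1 • c)) (by fun_prop))

theorem hasCompactSupport_transport (c : Space d) (a : ℝ) {W : ℝ × Space d → ℂ}
    (hW : HasCompactSupport W) : HasCompactSupport (transport c a W) :=
  (hW.comp_homeomorph (shear c)).mul_left

/-- The action of `transport` on test functions. -/
def transportTest (c : Space d) (a : ℝ) (Φ : 𝓓(spaceTime d, ℂ)) : 𝓓(spaceTime d, ℂ) where
  toFun := transport c a Φ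
  contDiff' := contDiff_transport c a Φ.contDiff
  hasCompactSupport' := hasCompactSupport_transport c a Φ.hasCompactSupport
  tsupport_subset' :=
    calc tsupport (transport c a Φ) ⊆ tsupport (Φ ∘ shear c) := tsupport_mul_subset_right
      _ = shear c ⁻¹' tsupport Φ := tsupport_comp_eq_preimage Φ (shear c)
      _ ⊆ shear c ⁻¹' spaceTime d := preimage_mono Φ.tsupport_subset
      _ = spaceTime d := shear_preimage_spaceTime c

theorem transportTest_apply (c : Space d) (a : ℝ) (Φ : 𝓓(spaceTime d, ℂ)) (p : ℝ × Space d) :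
    transportTest c a Φ p = wave a p.1 * Φ (shear c p) := rfl

theorem transportTest_transportTest_neg (c : Space d) (a : ℝ) (Φ : 𝓓(spaceTime d, ℂ)) :
    transportTest (-c) a (transportTest c (-a) Φ) = Φ := by
  ext p
  have inverse := congrFun (transport_transport_neg (-c) a Φ) p
  rwa [neg_neg] at inverse

theorem hasDerivAt_test_time (Φ : 𝓓(spaceTime d, ℂ)) (p : ℝ × Space d) :
    HasDerivAt (fun s => Φ (s, p.2)) ((∂_{((1, 0) : ℝ × Space d)} Φ) p) p.1 := by
  rw [lineDerivOp_test_apply]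
  exact (Φ.contDiff.differentiable (by simp) p).hasFDerivAt.comp_hasDerivAt p.1
    ((hasDerivAt_id p.1).prodMk (hasDerivAt_const p.1 p.2))

theorem hasCompactSupport_slice {X Y R : Type*} [TopologicalSpace X] [TopologicalSpace Y]
    [R1Space Y] [Zero R] {f : X × Y → R} (hf : HasCompactSupport f) (x : X) :
    HasCompactSupport fun y => f (x, y) :=
  HasCompactSupport.intro (hf.isCompact.image continuous_snd) fun y hy =>
    by_contra fun hne => hy ⟨(x, y), subset_tsupport _ hne, rfl⟩

theorem multTranspose_affineSymbol_test (c : Space d) (a : ℝ) (Φ : 𝓓(spaceTime d, ℂ))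
    (p : ℝ × Space d) :
    multTranspose (affineSymbol c a) (fun x => Φ (p.1, x)) p.2 =
      Complex.I * (∂_{((0, c) : ℝ × Space d)} Φ) p + a * Φ p := by
  have hasFDerivAt_slice : HasFDerivAt (fun x => Φ (p.1, x))
      (fderiv ℝ Φ p ∘L ContinuousLinearMap.inr ℝ ℝ (Space d)) p.2 :=
    HasFDerivAt.comp (g := Φ) p.2 (Φ.contDiff.differentiable (by simp) p).hasFDerivAt
      (hasFDerivAt_prodMk_right p.1 p.2)
  refine (multTranspose_affineSymbol c a ((hasCompactSupport_slice Φ.hasCompactSupport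
    p.1).toSchwartzMap (Φ.contDiff.comp (contDiff_prodMk_right p.1))) p.2).trans ?_
  rw [lineDerivOp_test_apply]
  exact congrArg (Complex.I * · + a * Φ p) (congrArg (· c) hasFDerivAt_slice.fderiv)

theorem lineDerivOp_transportTest (c : Space d) (a : ℝ) (Φ : 𝓓(spaceTime d, ℂ))
    (p : ℝ × Space d) :
    (∂_{((1, 0) : ℝ × Space d)} (transportTest (-c) a Φ)) (shear c p) =
      wave a p.1 * ((∂_{((1, 0) : ℝ × Space d)} Φ) p - (∂_{((0, c) : ℝ × Space d)} Φ) p +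
        Complex.I * a * Φ p) := by
  refine (hasDerivAt_test_time (transportTest (-c) a Φ) (shear c p)).unique ?_
  have hasDerivAt_line : HasDerivAt (fun s => shear (-c) (s, (shear c p).2)) (1, -c) p.1 :=
    (hasDerivAt_id p.1).prodMk (by
      simpa using ((hasDerivAt_id p.1).smul_const (-c)).const_add (p.2 + p.1 • c))
  have hasDerivAt_comp : HasDerivAt (fun s => Φ (shear (-c) (s, (shear c p).2)))
      (fderiv ℝ Φ p (1, -c)) p.1 := by
    refine HasFDerivAt.comp_hasDerivAt p.1 ?_ hasDerivAt_line
    exact (shear_shear_neg c p).symm ▸ (Φ.contDiff.differentiable (by simp) p).hasFDerivAt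
  refine ((hasDerivAt_wave a p.1).mul hasDerivAt_comp).congr_deriv ?_
  have split : ((1, -c) : ℝ × Space d) = (1, 0) - (0, c) := by simp
  have shear_eq : shear (-c) (p.1, (shear c p).2) = p := shear_shear_neg c p
  rw [split, map_sub, shear_eq, lineDerivOp_test_apply, lineDerivOp_test_apply]
  ring

theorem transport_equation_integrand (c : Space d) (a : ℝ) (W : ℝ × Space d → ℂ)
    (Φ : 𝓓(spaceTime d, ℂ)) (p : ℝ × Space d) :
    -(Complex.I * transport c a W p * deriv (fun s => Φ (s, p.2)) p.1) +
        transport c a W p * multTranspose (affineSymbol c a) (fun x => Φ (p.1, x)) p.2 =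
      -Complex.I * ((∂_{((1, 0) : ℝ × Space d)} (transportTest (-c) a Φ)) (shear c p) •
        W (shear c p)) := by
  rw [(hasDerivAt_test_time Φ p).deriv, multTranspose_affineSymbol_test, lineDerivOp_transportTest,
    transport, smul_eq_mul]
  linear_combination (wave a p.1 * W (shear c p) * a * Φ p) * Complex.I_sq

theorem nonlin_transport_mul_test (c : Space d) (a σ : ℝ) (W : ℝ × Space d → ℂ)
    (Φ : 𝓓(spaceTime d, ℂ)) (p : ℝ × Space d) :
    nonlin σ (transport c a W p) * Φ p =
      transportTest (-c) a Φ (shear c p) • nonlin σ (W (shear c p)) := by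
  rw [nonlin_transport, transport, transportTest_apply, shear_shear_neg, smul_eq_mul]
  exact mul_right_comm _ _ _

theorem setIntegral_test_smul_comp_shear (c : Space d) (Θ : 𝓓(spaceTime d, ℂ))
    (f : ℝ × Space d → ℂ) :
    ∫ p in (spaceTime d : Set (ℝ × Space d)), Θ (shear c p) • f (shear c p) =
      ∫ p, Θ p • f p :=
  (setIntegral_comp_shear c fun p => Θ p • f p).trans <|
    setIntegral_eq_integral_of_forall_compl_eq_zero fun p hp => by
      rw [image_eq_zero_of_notMem_tsupport fun h => hp (Θ.tsupport_subset h), zero_smul]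

theorem forall_equation_transport_iff (c : Space d) (a lam σ : ℝ) (W : ℝ × Space d → ℂ) :
    (∀ Φ : 𝓓(spaceTime d, ℂ),
      ∫ p in (spaceTime d : Set (ℝ × Space d)),
        (-(Complex.I * transport c a W p * deriv (fun s => Φ (s, p.2)) p.1) +
          transport c a W p * multTranspose (affineSymbol c a) (fun x => Φ (p.1, x)) p.2) =
      ∫ p in (spaceTime d : Set (ℝ × Space d)),
        (lam : ℂ) * nonlin σ (transport c a W p) * Φ p) ↔
    HasWeakLineDeriv ℂ (spaceTime d) (1, 0) W fun p => -Complex.I * lam * nonlin σ (W p) := by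
  have equation_iff : ∀ Φ : 𝓓(spaceTime d, ℂ),
      ((∫ p in (spaceTime d : Set (ℝ × Space d)),
        (-(Complex.I * transport c a W p * deriv (fun s => Φ (s, p.2)) p.1) +
          transport c a W p * multTranspose (affineSymbol c a) (fun x => Φ (p.1, x)) p.2) =
      ∫ p in (spaceTime d : Set (ℝ × Space d)),
        (lam : ℂ) * nonlin σ (transport c a W p) * Φ p) ↔
      ∫ p, (∂_{((1, 0) : ℝ × Space d)} (transportTest (-c) a Φ)) p • W p =
        -∫ p, transportTest (-c) a Φ p • (-Complex.I * lam * nonlin σ (W p))) := fun Φ => by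
    simp_rw [transport_equation_integrand, mul_assoc (lam : ℂ), nonlin_transport_mul_test]
    rw [integral_const_mul, integral_const_mul, setIntegral_test_smul_comp_shear,
      setIntegral_test_smul_comp_shear c _ fun p => nonlin σ (W p)]
    simp_rw [smul_eq_mul, mul_left_comm _ (-Complex.I * lam), integral_const_mul]
    generalize ∫ p, (∂_{((1, 0) : ℝ × Space d)} (transportTest (-c) a Φ)) p * W p = A
    generalize ∫ p, transportTest (-c) a Φ p * nonlin σ (W p) = B
    constructor <;> intro h
    · linear_combination Complex.I * h + A * Complex.I_sq
    · linear_combination -Complex.I * h - lam * B * Complex.I_sq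
  refine ⟨fun h Θ => ?_, fun h Φ => (equation_iff Φ).2 (h _)⟩
  simpa only [transportTest_transportTest_neg] using (equation_iff (transportTest c (-a) Θ)).1 (h _)

end Transport

section Evolution

theorem continuous_flow {X : Type*} [TopologicalSpace X] {lam σ : ℝ} (hσ : 0 ≤ σ) {t : X → ℝ}
    {z : X → ℂ} (ht : Continuous t) (hz : Continuous z) :
    Continuous fun x => flow lam σ (t x) (z x) := by
  have continuous_speed : Continuous fun x => ‖z x‖ ^ (2 * σ) :=
    hz.norm.rpow_const fun _ => Or.inr (by positivity)
  unfold flow wave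
  fun_prop

theorem continuous_nonlin {σ : ℝ} (hσ : 0 ≤ σ) : Continuous (nonlin σ) := by
  have continuous_speed : Continuous fun z : ℂ => ‖z‖ ^ (2 * σ) :=
    continuous_norm.rpow_const fun _ => Or.inr (by positivity)
  unfold nonlin
  fun_prop

theorem hasDerivAt_flow (lam σ t : ℝ) (z : ℂ) :
    HasDerivAt (fun s => flow lam σ s z) (-Complex.I * lam * nonlin σ (flow lam σ t z)) t := by
  refine ((hasDerivAt_wave (-(lam * ‖z‖ ^ (2 * σ))) t).mul_const z).congr_deriv ?_
  rw [nonlin, norm_flow, flow]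
  push_cast
  ring

/-- The solution with datum `v`: the datum is moved by the transport and its phase by the flow. -/
def evolution (c : Space d) (a lam σ : ℝ) (v : Space d → ℝ) : ℝ × Space d → ℂ :=
  transport c a fun p => flow lam σ p.1 (v p.2)

theorem evolution_apply (c : Space d) (a lam σ : ℝ) (v : Space d → ℝ) (t : ℝ) (x : Space d) :
    evolution c a lam σ v (t, x) = wave a t * flow lam σ t (v (x + t • c)) := rfl

theorem continuous_evolution (c : Space d) (a lam : ℝ) {σ : ℝ} (hσ : 0 ≤ σ) {v : Space d → ℝ}
    (hv : Continuous v) : Continuous (evolution c a lam σ v) := by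
  have continuous_V : Continuous fun p : ℝ × Space d => flow lam σ p.1 (v p.2) :=
    continuous_flow hσ continuous_fst (by fun_prop)
  exact ((continuous_wave a).comp continuous_fst).mul (continuous_V.comp (shear c).continuous)

theorem hasWeakLineDeriv_flow (lam : ℝ) {σ : ℝ} (hσ : 0 ≤ σ) {v : Space d → ℝ}
    (hv : Continuous v) :
    HasWeakLineDeriv ℂ (spaceTime d) (1, 0) (fun p => flow lam σ p.1 (v p.2))
      fun p => -Complex.I * lam * nonlin σ (flow lam σ p.1 (v p.2)) := by
  have continuous_V : Continuous fun p : ℝ × Space d => flow lam σ p.1 (v p.2) :=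
    continuous_flow hσ continuous_fst (by fun_prop)
  have continuous_rhs : Continuous fun p : ℝ × Space d =>
      -Complex.I * lam * nonlin σ (flow lam σ p.1 (v p.2)) :=
    continuous_const.mul ((continuous_nonlin hσ).comp continuous_V)
  have : (volume : Measure (ℝ × Space d)).IsAddHaarMeasure :=
    inferInstanceAs ((volume : Measure ℝ).prod (volume : Measure (Space d))).IsAddHaarMeasure
  refine hasWeakLineDeriv_of_hasLineDerivAt (continuous_V.locallyIntegrable.locallyIntegrableOn _)
    (continuous_rhs.locallyIntegrable.locallyIntegrableOn _) fun p => ?_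
  have hasDerivAt_V := (hasDerivAt_flow lam σ (p.1 + 0) (v p.2)).comp_const_add p.1 0
  rw [add_zero] at hasDerivAt_V
  exact hasDerivAt_V.congr_of_eventuallyEq (.of_forall fun t => by simp)

end Evolution

/-! ### Weak solutions of ordinary differential equations -/

section HalfLine

/-- The open half line `(0,∞)`. -/
def halfLine : Opens ℝ := ⟨Ioi 0, isOpen_Ioi⟩

theorem exists_Ioo_superset {K : Set ℝ} (hK : IsCompact K) (hK0 : K ⊆ Ioi 0) :
    ∃ p q : ℝ, 0 < p ∧ p ≤ 1 ∧ 1 ≤ q ∧ K ⊆ Ioo p q := by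
  have insert_subset : insert 1 K ⊆ Ioi (0 : ℝ) := insert_subset (mem_Ioi.2 one_pos) hK0
  obtain ⟨p, hp, p_le⟩ := (hK.insert 1).exists_isLeast (insert_nonempty _ _)
  obtain ⟨q, -, le_q⟩ := (hK.insert 1).exists_isGreatest (insert_nonempty _ _)
  have p_pos : 0 < p := insert_subset hp
  have p_le_one := p_le (mem_insert 1 K)
  have one_le_q := le_q (mem_insert 1 K)
  refine ⟨p / 2, q + 1, by linarith, by linarith, by linarith, fun t ht => ?_⟩
  have p_le_t := p_le (mem_insert_of_mem 1 ht)
  have t_le_q := le_q (mem_insert_of_mem 1 ht)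
  exact ⟨by linarith, by linarith⟩

theorem exists_test_integral_eq_one : ∃ η : 𝓓(halfLine, ℝ), ∫ t, η t = 1 := by
  let b : ContDiffBump (2 : ℝ) := ⟨1 / 2, 1, by norm_num, by norm_num⟩
  refine ⟨⟨b.normed volume, b.contDiff_normed, b.hasCompactSupport_normed, ?_⟩, b.integral_normed⟩
  rw [b.tsupport_normed_eq, Real.closedBall_eq_Icc]
  exact fun t ht => one_pos.trans_le (le_trans (by norm_num [b]) ht.1)

theorem intervalIntegrable_of_locallyIntegrableOn_halfLine {E : Type*}
    [NormedAddCommGroup E] {g : ℝ → E}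
    (hg : LocallyIntegrableOn g halfLine) {p q : ℝ} (hp : 0 < p) (hq : 0 < q) :
    IntervalIntegrable g volume p q :=
  intervalIntegrable_iff.2 <| .mono_set (hg.integrableOn_compact_subset
    (fun _ ht => (lt_min hp hq).trans_le ht.1) isCompact_uIcc) uIoc_subset_uIcc

variable {F : Type*} [NormedAddCommGroup F] [NormedSpace ℝ F]

theorem lineDerivOp_one_apply (η : 𝓓(halfLine, F)) (t : ℝ) : (∂_{(1 : ℝ)} η) t = deriv η t := by
  rw [lineDerivOp_test_apply, fderiv_apply_one_eq_deriv]

theorem exists_lineDerivOp_eq [CompleteSpace F] {h : 𝓓(halfLine, F)} (integral_h : ∫ t, h t = 0) :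
    ∃ η : 𝓓(halfLine, F), ∂_{(1 : ℝ)} η = h := by
  obtain ⟨p, q, p_pos, -, -, tsupport_subset⟩ :=
    exists_Ioo_superset h.hasCompactSupport h.tsupport_subset
  have h_eq_zero : ∀ s ∉ Ioo p q, h s = 0 := fun s hs =>
    image_eq_zero_of_notMem_tsupport fun hs' => hs (tsupport_subset hs')
  have hasDerivAt_primitive : ∀ t, HasDerivAt (fun t => ∫ s in p..t, h s) (h t) t := fun t =>
    h.continuous.integral_hasStrictDerivAt p t |>.hasDerivAt
  have deriv_primitive : deriv (fun t => ∫ s in p..t, h s) = h :=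
    funext fun t => (hasDerivAt_primitive t).deriv
  have primitive_eq_zero : ∀ t ∉ Icc p q, ∫ s in p..t, h s = 0 := by
    intro t ht
    rcases lt_or_ge t p with htp | hpt
    · rw [intervalIntegral.integral_symm, intervalIntegral.integral_of_le htp.le, neg_eq_zero]
      exact setIntegral_eq_zero_of_forall_eq_zero fun s hs =>
        h_eq_zero s fun hs' => hs'.1.not_ge hs.2
    · have hqt : q < t := not_le.1 fun htq => ht ⟨hpt, htq⟩
      rw [intervalIntegral.integral_of_le hpt, ← integral_h]
      exact setIntegral_eq_integral_of_forall_compl_eq_zero fun s hs =>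
        h_eq_zero s fun hs' => hs ⟨hs'.1, hs'.2.le.trans hqt.le⟩
  have tsupport_primitive : tsupport (fun t => ∫ s in p..t, h s) ⊆ Icc p q :=
    closure_minimal (fun t ht => by_contra fun hc => ht (primitive_eq_zero t hc)) isClosed_Icc
  have contDiff_primitive : ContDiff ℝ ∞ fun t => ∫ s in p..t, h s := by
    rw [contDiff_infty_iff_deriv, deriv_primitive]
    exact ⟨fun t => (hasDerivAt_primitive t).differentiableAt, h.contDiff⟩
  refine ⟨⟨_, contDiff_primitive, .intro isCompact_Icc primitive_eq_zero,
    tsupport_primitive.trans fun t ht => p_pos.trans_le ht.1⟩, ?_⟩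
  ext t
  rw [lineDerivOp_one_apply]
  exact (hasDerivAt_primitive t).deriv

theorem HasWeakLineDeriv.sub {E 𝕜 : Type*} [NormedAddCommGroup E] [NormedSpace ℝ E]
    [MeasureSpace E] [OpensMeasurableSpace E] [RCLike 𝕜] [NormedSpace 𝕜 F] {Ω : Opens E} {v : E}
    {f₁ f₂ g₁ g₂ : E → F} (h₁ : HasWeakLineDeriv 𝕜 Ω v f₁ g₁) (h₂ : HasWeakLineDeriv 𝕜 Ω v f₂ g₂)
    (hf₁ : LocallyIntegrableOn f₁ Ω) (hf₂ : LocallyIntegrableOn f₂ Ω)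
    (hg₁ : LocallyIntegrableOn g₁ Ω) (hg₂ : LocallyIntegrableOn g₂ Ω) :
    HasWeakLineDeriv 𝕜 Ω v (fun x => f₁ x - f₂ x) fun x => g₁ x - g₂ x := by
  intro φ
  simp_rw [smul_sub]
  rw [integral_sub (integrable_test_smul _ hf₁) (integrable_test_smul _ hf₂),
    integral_sub (integrable_test_smul _ hg₁) (integrable_test_smul _ hg₂), h₁ φ, h₂ φ]
  abel

theorem ae_eq_const_of_hasWeakLineDeriv_zero [CompleteSpace F] {f : ℝ → F}
    (hf : LocallyIntegrableOn f halfLine)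
    (h : HasWeakLineDeriv ℝ halfLine (1 : ℝ) f fun _ => 0) :
    ∃ C : F, ∀ᵐ t, 0 < t → f t = C := by
  obtain ⟨η₀, integral_η₀⟩ := exists_test_integral_eq_one
  set C : F := ∫ t, η₀ t • f t
  have integrable_test (η : 𝓓(halfLine, ℝ)) : Integrable η :=
    η.continuous.integrable_of_hasCompactSupport η.hasCompactSupport
  have integral_test_smul (g : 𝓓(halfLine, ℝ)) : ∫ t, g t • f t = (∫ t, g t) • C := by
    obtain ⟨η, deriv_η⟩ := exists_lineDerivOp_eq (h := g - (∫ t, g t) • η₀) (by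
      change ∫ t, (g t - (∫ t, g t) • η₀ t) = 0
      rw [integral_sub (integrable_test g) ((integrable_test η₀).fun_smul _), integral_smul,
        integral_η₀, smul_eq_mul, mul_one, sub_self])
    have integral_deriv_η := h η
    simp_rw [deriv_η, smul_zero, integral_zero, neg_zero] at integral_deriv_η
    rw [← sub_eq_zero, ← integral_smul, ← integral_sub (integrable_test_smul g hf)
      ((integrable_test_smul η₀ hf).fun_smul _), ← integral_deriv_η]
    refine integral_congr_ae (.of_forall fun t => ?_)
    change _ = (g t - (∫ t, g t) • η₀ t) • f t
    rw [sub_smul, smul_assoc]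
  have ae_eq_zero := halfLine.isOpen.ae_eq_zero_of_integral_contDiff_smul_eq_zero (μ := volume)
    (hf.sub ((locallyIntegrable_const C).locallyIntegrableOn _))
    fun g hg hgc hgs => by
      let φ : 𝓓(halfLine, ℝ) := ⟨g, hg, hgc, hgs⟩
      change ∫ t, φ t • (f t - C) = 0
      simp_rw [smul_sub]
      rw [integral_sub (integrable_test_smul φ hf) ((integrable_test φ).smul_const C),
        integral_test_smul, integral_smul_const, sub_self]
  exact ⟨C, ae_eq_zero.mono fun t ht h0 => sub_eq_zero.1 (ht h0)⟩

theorem continuousOn_primitive_halfLine {g : ℝ → F} (hg : LocallyIntegrableOn g halfLine) :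
    ContinuousOn (fun t => ∫ s in (1 : ℝ)..t, g s) halfLine := by
  intro t (ht : 0 < t)
  have min_pos : 0 < min 1 (t / 2) := lt_min one_pos (half_pos ht)
  have min_le : min 1 (t / 2) ≤ t + 1 := (min_le_left _ _).trans (by linarith)
  have continuousOn_primitive := intervalIntegral.continuousOn_primitive_interval'
    (intervalIntegrable_of_locallyIntegrableOn_halfLine hg min_pos (by linarith : 0 < t + 1))
    (by rw [uIcc_of_le min_le]; exact ⟨min_le_left _ _, by linarith⟩ : (1 : ℝ) ∈ _)
  rw [uIcc_of_le min_le] at continuousOn_primitive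
  exact (continuousOn_primitive.continuousAt (Icc_mem_nhds
    ((min_le_right _ _).trans_lt (by linarith)) (by linarith))).continuousWithinAt

theorem locallyIntegrableOn_primitive_halfLine {g : ℝ → F} (hg : LocallyIntegrableOn g halfLine) :
    LocallyIntegrableOn (fun t => ∫ s in (1 : ℝ)..t, g s) halfLine :=
  (continuousOn_primitive_halfLine hg).locallyIntegrableOn halfLine.isOpen.measurableSet

theorem integral_deriv_mul_primitive (η : 𝓓(halfLine, ℝ)) {g : ℝ → ℝ}
    (hg : LocallyIntegrableOn g halfLine) :
    ∫ t, deriv η t * ∫ s in (1 : ℝ)..t, g s = -∫ t, η t * g t := by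
  obtain ⟨p, q, hp, hp1, h1q, tsupport_subset⟩ :=
    exists_Ioo_superset η.hasCompactSupport η.tsupport_subset
  have η_eq_zero {t : ℝ} (ht : t ∉ Ioo p q) : η t = 0 :=
    image_eq_zero_of_notMem_tsupport fun h => ht (tsupport_subset h)
  have deriv_η_eq_zero {t : ℝ} (ht : t ∉ Ioo p q) : deriv η t = 0 :=
    image_eq_zero_of_notMem_tsupport fun h => ht (tsupport_subset (tsupport_deriv_subset h))
  have integral_eq {f : ℝ → ℝ} (hf : ∀ t ∉ Ioo p q, f t = 0) : ∫ t, f t = ∫ t in p..q, f t := by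
    rw [intervalIntegral.integral_of_le (hp1.trans h1q)]
    exact (setIntegral_eq_integral_of_forall_compl_eq_zero fun t ht =>
      hf t fun ht' => ht (Ioo_subset_Ioc_self ht')).symm
  have one_mem : (1 : ℝ) ∈ uIcc p q := by rw [uIcc_of_le (hp1.trans h1q)]; exact ⟨hp1, h1q⟩
  have hg_pq := intervalIntegrable_of_locallyIntegrableOn_halfLine hg hp (one_pos.trans_le h1q)
  have parts := (η.contDiff.of_le (by simp)).contDiffOn.absolutelyContinuousOnInterval
    |>.integral_mul_deriv_eq_deriv_mul
      (hg_pq.absolutelyContinuousOnInterval_intervalIntegral one_mem)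
  rw [η_eq_zero (by simp : p ∉ Ioo p q), η_eq_zero (by simp : q ∉ Ioo p q), zero_mul, zero_mul,
    sub_zero, zero_sub] at parts
  rw [integral_eq fun t ht => by rw [deriv_η_eq_zero ht, zero_mul],
    integral_eq fun t ht => by rw [η_eq_zero ht, zero_mul], eq_neg_iff_add_eq_zero, add_comm,
    ← eq_neg_iff_add_eq_zero, ← parts]
  refine intervalIntegral.integral_congr_ae (hg_pq.ae_hasDerivAt_integral.mono fun t ht ht' => ?_)
  rw [(ht (uIoc_subset_uIcc ht') 1 one_mem).deriv]

theorem hasWeakLineDeriv_primitive [CompleteSpace F] {g : ℝ → F}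
    (hg : LocallyIntegrableOn g halfLine) :
    HasWeakLineDeriv ℝ halfLine (1 : ℝ) (fun t => ∫ s in (1 : ℝ)..t, g s) g := by
  intro η
  have hG := locallyIntegrableOn_primitive_halfLine hg
  refine (SeparatingDual.eq_iff_forall_dual_eq (R := ℝ)).2 fun L => ?_
  have hLg : LocallyIntegrableOn (fun t => L (g t)) halfLine := fun t ht =>
    (hg t ht).imp fun s hs => ⟨hs.1, L.integrable_comp hs.2⟩
  rw [map_neg, ← L.integral_comp_comm (integrable_test_smul _ hG),
    ← L.integral_comp_comm (integrable_test_smul _ hg)]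
  simp_rw [map_smul, smul_eq_mul, lineDerivOp_one_apply]
  rw [← integral_deriv_mul_primitive η hLg]
  refine integral_congr_ae (.of_forall fun t => ?_)
  by_cases ht : t ∈ tsupport η
  · exact congrArg (deriv η t * ·) (L.intervalIntegral_comp_comm
      (intervalIntegrable_of_locallyIntegrableOn_halfLine hg one_pos (η.tsupport_subset ht))).symm
  · have deriv_eq_zero : deriv η t = 0 :=
      image_eq_zero_of_notMem_tsupport fun h => ht (tsupport_deriv_subset h)
    simp only [deriv_eq_zero, zero_mul]

theorem HasWeakLineDeriv.ae_eq_primitive [CompleteSpace F] {f g : ℝ → F}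
    (h : HasWeakLineDeriv ℝ halfLine (1 : ℝ) f g) (hf : LocallyIntegrableOn f halfLine)
    (hg : LocallyIntegrableOn g halfLine) :
    ∃ C : F, ∀ᵐ t, 0 < t → f t = C + ∫ s in (1 : ℝ)..t, g s := by
  have hG := locallyIntegrableOn_primitive_halfLine hg
  have sub_weak := h.sub (hasWeakLineDeriv_primitive hg) hf hG hg hg
  simp only [sub_self] at sub_weak
  obtain ⟨C, hC⟩ := ae_eq_const_of_hasWeakLineDeriv_zero (hf.sub hG) sub_weak
  exact ⟨C, hC.mono fun t ht h0 => sub_eq_iff_eq_add.1 (ht h0)⟩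

theorem HasWeakLineDeriv.exists_hasDerivAt [CompleteSpace F] {N : F → F} (hN : Continuous N)
    {V : ℝ → F} (h : HasWeakLineDeriv ℝ halfLine (1 : ℝ) V fun t => N (V t))
    (hV : LocallyIntegrableOn V halfLine) (hNV : LocallyIntegrableOn (fun t => N (V t)) halfLine) :
    ∃ v : ℝ → F, (∀ᵐ t, 0 < t → V t = v t) ∧ ∀ t, 0 < t → HasDerivAt v (N (v t)) t := by
  obtain ⟨C, hC⟩ := h.ae_eq_primitive hV hNV
  set v : ℝ → F := fun t => C + ∫ s in (1 : ℝ)..t, N (V s) with v_def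
  have continuousOn_Nv : ContinuousOn (fun t => N (v t)) (Ioi 0) :=
    hN.comp_continuousOn (continuousOn_const.add (continuousOn_primitive_halfLine hNV))
  have v_eq {t : ℝ} (ht : 0 < t) : v t = C + ∫ s in (1 : ℝ)..t, N (v s) := by
    rw [v_def]
    refine congrArg (C + ·) (intervalIntegral.integral_congr_ae (hC.mono fun s hs hst => ?_))
    rw [hs ((lt_min one_pos ht).trans hst.1)]
  refine ⟨v, hC, fun t ht => ?_⟩
  have hasDerivAt_primitive : HasDerivAt (fun t => ∫ s in (1 : ℝ)..t, N (v s)) (N (v t)) t :=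
    intervalIntegral.integral_hasDerivAt_right
      (continuousOn_Nv.mono fun s hs => (lt_min one_pos ht).trans_le hs.1).intervalIntegrable
      (continuousOn_Nv.stronglyMeasurableAtFilter isOpen_Ioi t ht)
      (continuousOn_Nv.continuousAt (Ioi_mem_nhds ht))
  exact (hasDerivAt_primitive.const_add C).congr_of_eventuallyEq
    (Filter.mem_of_superset (Ioi_mem_nhds ht) fun s hs => v_eq hs)

end HalfLine

section PhaseEquation

variable {lam σ : ℝ}

theorem exists_forall_eq_of_hasDerivAt_zero {F : Type*} [NormedAddCommGroup F] [NormedSpace ℝ F]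
    {f : ℝ → F} (hf : ∀ t, 0 < t → HasDerivAt f 0 t) : ∃ C, ∀ t, 0 < t → f t = C :=
  isOpen_Ioi.exists_is_const_of_deriv_eq_zero isPreconnected_Ioi
    (fun t ht => (hf t ht).differentiableAt.differentiableWithinAt) fun t ht => (hf t ht).deriv

theorem hasDerivAt_norm_sq_of_phase_equation {v : ℝ → ℂ} {t : ℝ}
    (hv : HasDerivAt v (-Complex.I * lam * nonlin σ (v t)) t) :
    HasDerivAt (fun t => ‖v t‖ ^ 2) 0 t := by
  refine hv.norm_sq.congr_deriv ?_
  have conj_mul_eq : -Complex.I * lam * nonlin σ (v t) * (starRingEnd ℂ) (v t) =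
      ((-(lam * ‖v t‖ ^ (2 * σ) * Complex.normSq (v t)) : ℝ) : ℂ) * Complex.I := by
    rw [nonlin]
    push_cast
    rw [← Complex.mul_conj]
    ring
  rw [Complex.inner, conj_mul_eq, Complex.re_ofReal_mul, Complex.I_re, mul_zero, mul_zero]

theorem exists_eq_flow_of_hasDerivAt {v : ℝ → ℂ}
    (hv : ∀ t, 0 < t → HasDerivAt v (-Complex.I * lam * nonlin σ (v t)) t) :
    ∃ A : ℂ, ∀ t, 0 < t → v t = flow lam σ t A := by
  obtain ⟨k, hk⟩ := exists_forall_eq_of_hasDerivAt_zero fun t ht =>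
    hasDerivAt_norm_sq_of_phase_equation (hv t ht)
  have norm_eq {t : ℝ} (ht : 0 < t) : ‖v t‖ = √k := by rw [← hk t ht, Real.sqrt_sq (norm_nonneg _)]
  set b : ℝ := lam * √k ^ (2 * σ) with b_def
  obtain ⟨A, hA⟩ := exists_forall_eq_of_hasDerivAt_zero (f := fun t => wave b t * v t)
    fun t ht => by
      refine ((hasDerivAt_wave b t).mul (hv t ht)).congr_deriv ?_
      rw [nonlin, norm_eq ht, b_def]
      push_cast
      ring
  have norm_A : ‖A‖ = √k := by
    rw [← hA 1 one_pos, norm_mul, norm_wave, one_mul, norm_eq one_pos]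
  refine ⟨A, fun t ht => ?_⟩
  rw [flow, norm_A, ← b_def, ← hA t ht, ← mul_assoc, wave_neg_mul_wave, one_mul]

theorem HasWeakLineDeriv.ae_eq_flow (hσ : 0 ≤ σ) {V : ℝ → ℂ}
    (h : HasWeakLineDeriv ℝ halfLine (1 : ℝ) V fun t => -Complex.I * lam * nonlin σ (V t))
    (hV : LocallyIntegrableOn V halfLine)
    (hNV : LocallyIntegrableOn (fun t => -Complex.I * lam * nonlin σ (V t)) halfLine) :
    ∃ A : ℂ, ∀ᵐ t, 0 < t → V t = flow lam σ t A := by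
  obtain ⟨v, hVv, hv⟩ := HasWeakLineDeriv.exists_hasDerivAt
    (N := fun z => -Complex.I * lam * nonlin σ z)
    (continuous_const.mul (continuous_nonlin hσ)) h hV hNV
  obtain ⟨A, hA⟩ := exists_eq_flow_of_hasDerivAt hv
  exact ⟨A, hVv.mono fun t ht h0 => (ht h0).trans (hA t h0)⟩

end PhaseEquation

/-! ### Slicing a weak equation on space-time -/

section Slicing

/-- The intervals `[1/(n+1), n]`, which exhaust `(0,∞)`. -/
def compactInterval (n : ℕ) : Set ℝ := Icc (1 / ((n : ℝ) + 1)) n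

theorem isCompact_compactInterval (n : ℕ) : IsCompact (compactInterval n) := isCompact_Icc

theorem compactInterval_subset_halfLine (n : ℕ) : compactInterval n ⊆ halfLine :=
  fun _ ht => (by positivity : 0 < 1 / ((n : ℝ) + 1)).trans_le ht.1

theorem eventually_subset_compactInterval {K : Set ℝ} (hK : IsCompact K) (hK0 : K ⊆ halfLine) :
    ∀ᶠ n : ℕ in atTop, K ⊆ compactInterval n := by
  obtain ⟨p, q, hp, -, -, hpq⟩ := exists_Ioo_superset hK hK0
  have left_le : ∀ᶠ n : ℕ in atTop, 1 / ((n : ℝ) + 1) ≤ p :=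
    (tendsto_one_div_add_atTop_nhds_zero_nat (𝕜 := ℝ)).eventually_le_const hp
  filter_upwards [left_le, tendsto_natCast_atTop_atTop.eventually_ge_atTop q] with n hpn hqn
  exact fun t ht => ⟨hpn.trans (hpq ht).1.le, (hpq ht).2.le.trans hqn⟩

theorem ae_locallyIntegrableOn_slice {V : ℝ × Space d → ℂ}
    (hV : LocallyIntegrableOn V (spaceTime d)) :
    ∀ᵐ y : Space d, LocallyIntegrableOn (fun t => V (t, y)) halfLine := by
  have ae_integrableOn_slice (n : ℕ) : ∀ᵐ y : Space d, y ∈ Metric.closedBall (0 : Space d) n →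
      IntegrableOn (fun t => V (t, y)) (compactInterval n) := by
    have integrableOn_prod : IntegrableOn V (compactInterval n ×ˢ Metric.closedBall 0 n) :=
      hV.integrableOn_compact_subset
        (prod_mono (compactInterval_subset_halfLine n) (subset_univ _))
        ((isCompact_compactInterval n).prod (isCompact_closedBall _ _))
    rw [IntegrableOn, Measure.volume_eq_prod, ← Measure.prod_restrict] at integrableOn_prod
    exact (ae_restrict_iff' Metric.isClosed_closedBall.measurableSet).1
      integrableOn_prod.prod_left_ae
  filter_upwards [ae_all_iff.2 ae_integrableOn_slice] with y hy
  refine (locallyIntegrableOn_iff halfLine.isOpen.isLocallyClosed).2 fun K hK hKc => ?_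
  obtain ⟨n, K_subset, norm_le⟩ := ((eventually_subset_compactInterval hKc hK).and
    (tendsto_natCast_atTop_atTop.eventually_ge_atTop ‖y‖)).exists
  exact (hy n (by simpa using norm_le)).mono_set K_subset

theorem exists_countable_dense_test_of_isCompact {Ω : Opens ℝ} {K : Set ℝ} (hK : IsCompact K) :
    ∃ S : Set 𝓓(Ω, ℝ), S.Countable ∧ (∀ ψ ∈ S, tsupport ψ ⊆ K) ∧
      ∀ η : 𝓓(Ω, ℝ), tsupport η ⊆ K → ∀ ε > 0, ∃ ψ ∈ S, ∀ t,
        ‖η t - ψ t‖ ≤ ε ∧ ‖deriv η t - deriv ψ t‖ ≤ ε := by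
  have := isCompact_iff_compactSpace.1 hK
  have continuous_deriv (η : 𝓓(Ω, ℝ)) : Continuous (deriv η) :=
    η.contDiff.continuous_deriv (by simp)
  let jet (η : 𝓓(Ω, ℝ)) : C(K, ℝ) × C(K, ℝ) :=
    (⟨fun t => η t, η.continuous.comp continuous_subtype_val⟩,
      ⟨fun t => deriv η t, (continuous_deriv η).comp continuous_subtype_val⟩)
  obtain ⟨T, T_subset, T_countable, T_dense⟩ := (TopologicalSpace.IsSeparable.of_separableSpace
    (jet '' {η | tsupport η ⊆ K})).exists_countable_dense_subset
  choose! φ tsupport_φ jet_φ using fun b (hb : b ∈ T) => T_subset hb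
  refine ⟨φ '' T, T_countable.image φ, forall_mem_image.2 tsupport_φ,
    fun η hη ε hε => ?_⟩
  obtain ⟨b, hb, dist_lt⟩ := Metric.mem_closure_iff.1 (T_dense ⟨η, hη, rfl⟩) ε hε
  rw [← jet_φ b hb, Prod.dist_eq, max_lt_iff] at dist_lt
  refine ⟨φ b, mem_image_of_mem φ hb, fun t => ?_⟩
  by_cases ht : t ∈ K
  · exact ⟨(ContinuousMap.dist_apply_le_dist ⟨t, ht⟩).trans dist_lt.1.le,
      (ContinuousMap.dist_apply_le_dist ⟨t, ht⟩).trans dist_lt.2.le⟩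
  · have eq_zero {ψ : 𝓓(Ω, ℝ)} (hψ : tsupport ψ ⊆ K) : ψ t = 0 ∧ deriv ψ t = 0 :=
      ⟨image_eq_zero_of_notMem_tsupport fun h => ht (hψ h),
        image_eq_zero_of_notMem_tsupport fun h => ht (hψ (tsupport_deriv_subset h))⟩
    simp [eq_zero hη, eq_zero (tsupport_φ b hb), hε.le]

theorem exists_countable_dense_test :
    ∃ S : Set 𝓓(halfLine, ℝ), S.Countable ∧ ∀ η : 𝓓(halfLine, ℝ), ∃ K, IsCompact K ∧
      K ⊆ halfLine ∧ ∀ ε > 0, ∃ ψ ∈ S, tsupport (η - ψ) ⊆ K ∧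
        ∀ t, ‖(η - ψ) t‖ ≤ ε ∧ ‖deriv (η - ψ) t‖ ≤ ε := by
  choose S S_countable S_tsupport S_dense using fun n =>
    exists_countable_dense_test_of_isCompact (Ω := halfLine) (isCompact_compactInterval n)
  refine ⟨⋃ n, S n, countable_iUnion S_countable, fun η => ?_⟩
  obtain ⟨n, hn⟩ :=
    (eventually_subset_compactInterval η.hasCompactSupport η.tsupport_subset).exists
  refine ⟨_, isCompact_compactInterval n, compactInterval_subset_halfLine n, fun ε hε => ?_⟩
  obtain ⟨ψ, hψ, dist_le⟩ := S_dense n η hn ε hε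
  refine ⟨ψ, mem_iUnion_of_mem n hψ,
    (tsupport_sub _ _).trans (union_subset hn (S_tsupport n ψ hψ)), fun t => ⟨(dist_le t).1, ?_⟩⟩
  change ‖deriv (⇑η - ⇑ψ) t‖ ≤ ε
  rw [deriv_sub (η.contDiff.differentiable (by simp) t) (ψ.contDiff.differentiable (by simp) t)]
  exact (dist_le t).2

theorem norm_integral_smul_le {X F : Type*} [MeasurableSpace X] {μ : Measure X}
    [NormedAddCommGroup F] [NormedSpace ℝ F] {K : Set X} {f : X → F} (hf : IntegrableOn f K μ)
    {φ : X → ℝ} {ε : ℝ} (φ_eq_zero : ∀ x ∉ K, φ x = 0) (norm_le : ∀ x, ‖φ x‖ ≤ ε) :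
    ‖∫ x, φ x • f x ∂μ‖ ≤ ε * ∫ x in K, ‖f x‖ ∂μ := by
  rw [← setIntegral_eq_integral_of_forall_compl_eq_zero (s := K)
    fun x hx => by rw [φ_eq_zero x hx, zero_smul], ← integral_const_mul]
  refine norm_integral_le_of_norm_le (hf.norm.const_mul ε) (.of_forall fun x => ?_)
  rw [norm_smul]
  exact mul_le_mul_of_nonneg_right (norm_le x) (norm_nonneg _)

theorem hasWeakLineDeriv_halfLine_of_dense {F : Type*} [NormedAddCommGroup F] [NormedSpace ℝ F]
    {f g : ℝ → F} (hf : LocallyIntegrableOn f halfLine) (hg : LocallyIntegrableOn g halfLine)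
    {S : Set 𝓓(halfLine, ℝ)}
    (hS : ∀ η : 𝓓(halfLine, ℝ), ∃ K, IsCompact K ∧ K ⊆ halfLine ∧ ∀ ε > 0, ∃ ψ ∈ S,
      tsupport (η - ψ) ⊆ K ∧ ∀ t, ‖(η - ψ) t‖ ≤ ε ∧ ‖deriv (η - ψ) t‖ ≤ ε)
    (h : ∀ ψ ∈ S, ∫ t, (∂_{(1 : ℝ)} ψ) t • f t = -∫ t, ψ t • g t) :
    HasWeakLineDeriv ℝ halfLine (1 : ℝ) f g := by
  intro η
  obtain ⟨K, hK, K_subset, hη⟩ := hS η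
  have hfK := hf.integrableOn_compact_subset K_subset hK
  have hgK := hg.integrableOn_compact_subset K_subset hK
  let defect (φ : 𝓓(halfLine, ℝ)) : F := (∫ t, (∂_{(1 : ℝ)} φ) t • f t) + ∫ t, φ t • g t
  have defect_add (φ ψ : 𝓓(halfLine, ℝ)) : defect (φ + ψ) = defect φ + defect ψ := by
    simp only [defect, LineDeriv.lineDerivOp_add, _root_.add_apply, add_smul]
    rw [integral_add (integrable_test_smul _ hf) (integrable_test_smul _ hf),
      integral_add (integrable_test_smul _ hg) (integrable_test_smul _ hg)]
    abel
  suffices norm_defect_le : ∀ ε > 0, ‖defect η‖ ≤ ε * ((∫ t in K, ‖f t‖) + ∫ t in K, ‖g t‖) by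
    have tendsto_bound : Tendsto (fun ε : ℝ => ε * ((∫ t in K, ‖f t‖) + ∫ t in K, ‖g t‖))
        (𝓝[>] 0) (𝓝 0) :=
      ((continuous_mul_const _).tendsto' _ _ (zero_mul _)).mono_left nhdsWithin_le_nhds
    exact eq_neg_of_add_eq_zero_left <| norm_le_zero_iff.1 <|
      ge_of_tendsto tendsto_bound (eventually_mem_nhdsWithin.mono norm_defect_le)
  intro ε hε
  obtain ⟨ψ, hψ, tsupport_subset, norm_le⟩ := hη ε hε
  have defect_eq : defect η = defect (η - ψ) := by
    rw [← sub_add_cancel η ψ, defect_add, sub_add_cancel, add_eq_left]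
    exact add_eq_zero_iff_eq_neg.2 (h ψ hψ)
  rw [defect_eq, mul_add]
  simp only [defect, lineDerivOp_one_apply]
  exact (norm_add_le _ _).trans (add_le_add
    (norm_integral_smul_le hfK (fun t ht => image_eq_zero_of_notMem_tsupport fun h =>
      ht (tsupport_subset (tsupport_deriv_subset h))) fun t => (norm_le t).2)
    (norm_integral_smul_le hgK (fun t ht => image_eq_zero_of_notMem_tsupport fun h =>
      ht (tsupport_subset h)) fun t => (norm_le t).1))

theorem tsupport_ofReal_mul_subset {X Y : Type*} [TopologicalSpace X] [TopologicalSpace Y]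
    (θ : X → ℝ) (χ : Y → ℝ) :
    tsupport (fun p : X × Y => ((θ p.1 * χ p.2 : ℝ) : ℂ)) ⊆ tsupport θ ×ˢ tsupport χ := by
  refine closure_minimal (fun p hp => ?_) ((isClosed_tsupport θ).prod (isClosed_tsupport χ))
  have mul_ne_zero : θ p.1 * χ p.2 ≠ 0 := Complex.ofReal_ne_zero.1 hp
  exact ⟨subset_tsupport θ (left_ne_zero_of_mul mul_ne_zero),
    subset_tsupport χ (right_ne_zero_of_mul mul_ne_zero)⟩

/-- The test function `(t, x) ↦ θ(t) χ(x)` on space-time. -/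
def tensorTest (θ : 𝓓(halfLine, ℝ)) (χ : 𝓓((⊤ : Opens (Space d)), ℝ)) : 𝓓(spaceTime d, ℂ) where
  toFun p := ((θ p.1 * χ p.2 : ℝ) : ℂ)
  contDiff' := Complex.ofRealCLM.contDiff.comp
    ((θ.contDiff.comp contDiff_fst).mul (χ.contDiff.comp contDiff_snd))
  hasCompactSupport' := (θ.hasCompactSupport.isCompact.prod χ.hasCompactSupport.isCompact)
    |>.of_isClosed_subset (isClosed_tsupport _) (tsupport_ofReal_mul_subset θ χ)
  tsupport_subset' := (tsupport_ofReal_mul_subset θ χ).trans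
    (prod_mono θ.tsupport_subset (subset_univ _))

theorem tensorTest_apply (θ : 𝓓(halfLine, ℝ)) (χ : 𝓓((⊤ : Opens (Space d)), ℝ))
    (p : ℝ × Space d) : tensorTest θ χ p = ((θ p.1 * χ p.2 : ℝ) : ℂ) := rfl

theorem lineDerivOp_tensorTest (θ : 𝓓(halfLine, ℝ)) (χ : 𝓓((⊤ : Opens (Space d)), ℝ)) :
    ∂_{((1, 0) : ℝ × Space d)} (tensorTest θ χ) = tensorTest (∂_{(1 : ℝ)} θ) χ := by
  ext p
  rw [lineDerivOp_test_apply, tensorTest_apply, lineDerivOp_one_apply]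
  refine (hasDerivAt_test_time (tensorTest θ χ) p).unique ?_
  exact (((θ.contDiff.differentiable (by simp) p.1).hasDerivAt).mul_const (χ p.2)).ofReal_comp

theorem integral_tensorTest_smul (θ : 𝓓(halfLine, ℝ)) (χ : 𝓓((⊤ : Opens (Space d)), ℝ))
    {V : ℝ × Space d → ℂ} (hV : LocallyIntegrableOn V (spaceTime d)) :
    ∫ p, tensorTest θ χ p • V p = ∫ y, χ y • ∫ t, θ t • V (t, y) := by
  rw [Measure.volume_eq_prod, integral_prod_symm _ (integrable_test_smul _ hV)]
  refine integral_congr_ae (.of_forall fun y => ?_)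
  simp only [← integral_smul, tensorTest_apply, mul_smul, Complex.coe_smul]
  exact integral_congr_ae (.of_forall fun t => smul_comm _ _ _)

theorem locallyIntegrable_integral_test_smul (θ : 𝓓(halfLine, ℝ)) {V : ℝ × Space d → ℂ}
    (hV : LocallyIntegrableOn V (spaceTime d)) :
    LocallyIntegrable fun y => ∫ t, θ t • V (t, y) := by
  intro y₀
  let b : ContDiffBump y₀ := ⟨1, 2, one_pos, one_lt_two⟩
  let χ : 𝓓((⊤ : Opens (Space d)), ℝ) := ⟨b, b.contDiff, b.hasCompactSupport, fun _ _ => trivial⟩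
  refine ⟨Metric.closedBall y₀ 1, Metric.closedBall_mem_nhds y₀ one_pos, ?_⟩
  have integrable_slice := (integrable_test_smul (tensorTest θ χ) hV).integral_prod_right
  refine integrable_slice.integrableOn.congr_fun (fun y hy => ?_)
    Metric.isClosed_closedBall.measurableSet
  refine integral_congr_ae (.of_forall fun t => ?_)
  have χ_eq_one : χ y = 1 := b.one_of_mem_closedBall hy
  simp only [tensorTest_apply, χ_eq_one, mul_one, Complex.coe_smul]

theorem HasWeakLineDeriv.ae_integral_slice {V G : ℝ × Space d → ℂ}
    (h : HasWeakLineDeriv ℂ (spaceTime d) (1, 0) V G) (hV : LocallyIntegrableOn V (spaceTime d))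
    (hG : LocallyIntegrableOn G (spaceTime d)) (η : 𝓓(halfLine, ℝ)) :
    ∀ᵐ y : Space d, ∫ t, (∂_{(1 : ℝ)} η) t • V (t, y) = -∫ t, η t • G (t, y) := by
  have hV' := locallyIntegrable_integral_test_smul (∂_{(1 : ℝ)} η) hV
  have hG' := locallyIntegrable_integral_test_smul η hG
  refine (ae_eq_zero_of_integral_contDiff_smul_eq_zero (hV'.add hG') fun χ hχ hχc => ?_).mono
    fun y hy => eq_neg_of_add_eq_zero_left hy
  let ψ : 𝓓((⊤ : Opens (Space d)), ℝ) := ⟨χ, hχ, hχc, fun _ _ => trivial⟩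
  have weak_eq := h (tensorTest η ψ)
  rw [lineDerivOp_tensorTest, integral_tensorTest_smul _ ψ hV, integral_tensorTest_smul _ ψ hG,
    ← add_eq_zero_iff_eq_neg, ← integral_add] at weak_eq
  · simp only [← smul_add] at weak_eq
    exact weak_eq
  · exact hV'.integrable_smul_left_of_hasCompactSupport hχ.continuous hχc
  · exact hG'.integrable_smul_left_of_hasCompactSupport hχ.continuous hχc

theorem HasWeakLineDeriv.ae_slice {V G : ℝ × Space d → ℂ}
    (h : HasWeakLineDeriv ℂ (spaceTime d) (1, 0) V G) (hV : LocallyIntegrableOn V (spaceTime d))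
    (hG : LocallyIntegrableOn G (spaceTime d)) :
    ∀ᵐ y : Space d, HasWeakLineDeriv ℝ halfLine (1 : ℝ) (fun t => V (t, y)) fun t => G (t, y) := by
  obtain ⟨S, S_countable, S_dense⟩ := exists_countable_dense_test
  filter_upwards [(ae_ball_iff S_countable).2 fun ψ _ => h.ae_integral_slice hV hG ψ,
    ae_locallyIntegrableOn_slice hV, ae_locallyIntegrableOn_slice hG] with y hy hVy hGy
  exact hasWeakLineDeriv_halfLine_of_dense hVy hGy S_dense hy

end Slicing

/-! ### Uniqueness -/

section Uniqueness

theorem flow_neg_flow (lam σ t : ℝ) (z : ℂ) : flow lam σ (-t) (flow lam σ t z) = z := by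
  have wave_inv : wave (-(lam * ‖z‖ ^ (2 * σ))) (-t) * wave (-(lam * ‖z‖ ^ (2 * σ))) t = 1 := by
    simpa [wave] using wave_neg_mul_wave (-(lam * ‖z‖ ^ (2 * σ))) t
  rw [flow, norm_flow, flow, ← mul_assoc, wave_inv, one_mul]

theorem aestronglyMeasurable_flow {X : Type*} [MeasurableSpace X] {μ : Measure X} (lam : ℝ) {σ : ℝ}
    (hσ : 0 ≤ σ) {t : X → ℝ} {z : X → ℂ} (ht : AEStronglyMeasurable t μ)
    (hz : AEStronglyMeasurable z μ) : AEStronglyMeasurable (fun x => flow lam σ (t x) (z x)) μ := by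
  have continuous_uncurry : Continuous fun q : ℝ × ℂ => flow lam σ q.1 q.2 :=
    continuous_flow hσ continuous_fst continuous_snd
  exact Continuous.comp_aestronglyMeasurable (g := fun q : ℝ × ℂ => flow lam σ q.1 q.2)
    (f := fun x => (t x, z x)) continuous_uncurry (ht.prodMk hz)

theorem ae_ae_eq_comm {X Y Z : Type*} [MeasurableSpace X] [MeasurableSpace Y] [TopologicalSpace Z]
    [MetrizableSpace Z] {μ : Measure X} {ν : Measure Y} [SFinite μ] [SFinite ν] {f g : X × Y → Z}
    (hf : AEStronglyMeasurable f (μ.prod ν)) (hg : AEStronglyMeasurable g (μ.prod ν)) :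
    (∀ᵐ x ∂μ, ∀ᵐ y ∂ν, f (x, y) = g (x, y)) ↔ ∀ᵐ y ∂ν, ∀ᵐ x ∂μ, f (x, y) = g (x, y) := by
  obtain ⟨s, -, s_measurable, hs_ae⟩ :=
    (hf.nullMeasurableSet_eq_fun hg).exists_measurable_subset_ae_eq
  have mem_iff : ∀ᵐ p ∂μ.prod ν, p ∈ s ↔ f p = g p := hs_ae.mem_iff
  have mem_iff_left := Measure.ae_ae_of_ae_prod mem_iff
  have mem_iff_right : ∀ᵐ y ∂ν, ∀ᵐ x ∂μ, (x, y) ∈ s ↔ f (x, y) = g (x, y) :=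
    Measure.ae_ae_of_ae_prod (Measure.measurePreserving_swap.quasiMeasurePreserving.ae mem_iff)
  calc _ ↔ ∀ᵐ x ∂μ, ∀ᵐ y ∂ν, (x, y) ∈ s := eventually_congr <|
        mem_iff_left.mono fun _ h => eventually_congr (h.mono fun _ => Iff.symm)
    _ ↔ ∀ᵐ y ∂ν, ∀ᵐ x ∂μ, (x, y) ∈ s := Measure.ae_ae_comm s_measurable
    _ ↔ _ := eventually_congr <| mem_iff_right.mono fun _ h => eventually_congr h

theorem locallyIntegrable_average_flow (lam : ℝ) {σ : ℝ} (hσ : 0 ≤ σ) {V : ℝ × Space d → ℂ}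
    (hV : LocallyIntegrableOn V (spaceTime d)) :
    LocallyIntegrable fun y => ∫ t in Icc (1 : ℝ) 2, flow lam σ (-t) (V (t, y)) := by
  refine locallyIntegrable_iff.2 fun K hK => ?_
  have box_subset : Icc (1 : ℝ) 2 ×ˢ K ⊆ spaceTime d :=
    fun p hp => ⟨zero_lt_one.trans_le hp.1.1, trivial⟩
  have integrable_V : Integrable V ((volume.restrict (Icc 1 2)).prod (volume.restrict K)) := by
    rw [Measure.prod_restrict]
    exact hV.integrableOn_compact_subset box_subset (isCompact_Icc.prod hK)
  have integrable_flow : Integrable (fun p : ℝ × Space d => flow lam σ (-p.1) (V p))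
      ((volume.restrict (Icc 1 2)).prod (volume.restrict K)) :=
    integrable_V.mono (aestronglyMeasurable_flow lam hσ (by fun_prop) integrable_V.1)
      (.of_forall fun p => (norm_flow ..).le)
  exact integrable_flow.integral_prod_right

theorem exists_profile {lam σ : ℝ} (hσ : 0 ≤ σ) {V : ℝ × Space d → ℂ}
    (hV : LocallyIntegrableOn V (spaceTime d))
    (h : ∀ᵐ y : Space d, ∃ z : ℂ, ∀ᵐ t, 0 < t → V (t, y) = flow lam σ t z) :
    ∃ A : Space d → ℂ, LocallyIntegrable A ∧
      ∀ᵐ t, 0 < t → ∀ᵐ y : Space d, V (t, y) = flow lam σ t (A y) := by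
  -- Averaging the pulled back values makes the pointwise amplitude depend measurably on `y`.
  have average_eq {y : Space d} {z : ℂ} (hz : ∀ᵐ t, 0 < t → V (t, y) = flow lam σ t z) :
      ∫ t in Icc (1 : ℝ) 2, flow lam σ (-t) (V (t, y)) = z := by
    have pullback_eq : ∀ᵐ t, t ∈ Icc (1 : ℝ) 2 → flow lam σ (-t) (V (t, y)) = z := by
      filter_upwards [hz] with t ht htm
      rw [ht (zero_lt_one.trans_le htm.1), flow_neg_flow]
    rw [setIntegral_congr_ae measurableSet_Icc pullback_eq]
    norm_num
  have locallyIntegrable_average := locallyIntegrable_average_flow lam hσ hV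
  refine ⟨_, locallyIntegrable_average, ?_⟩
  have aestronglyMeasurable_V :
      AEStronglyMeasurable V ((volume.restrict (Ioi 0)).prod (volume : Measure (Space d))) := by
    rw [← Measure.restrict_univ (μ := (volume : Measure (Space d))), Measure.prod_restrict]
    exact hV.aestronglyMeasurable
  refine (ae_restrict_iff' measurableSet_Ioi).1 ((ae_ae_eq_comm aestronglyMeasurable_V
    (aestronglyMeasurable_flow lam hσ measurable_fst.aestronglyMeasurable
      locallyIntegrable_average.aestronglyMeasurable.comp_snd)).2 ?_)
  filter_upwards [h] with y ⟨z, hz⟩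
  rw [average_eq hz]
  exact (ae_restrict_iff' measurableSet_Ioi).2 hz

theorem HasWeakLineDeriv.exists_profile {lam σ : ℝ} (hσ : 0 ≤ σ) {V : ℝ × Space d → ℂ}
    (h : HasWeakLineDeriv ℂ (spaceTime d) (1, 0) V fun p => -Complex.I * lam * nonlin σ (V p))
    (hV : LocallyIntegrableOn V (spaceTime d))
    (hNV : LocallyIntegrableOn (fun p => nonlin σ (V p)) (spaceTime d)) :
    ∃ A : Space d → ℂ, LocallyIntegrable A ∧
      ∀ᵐ t, 0 < t → ∀ᵐ y : Space d, V (t, y) = flow lam σ t (A y) := by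
  have hG : LocallyIntegrableOn (fun p => -Complex.I * lam * nonlin σ (V p)) (spaceTime d) :=
    hNV.smul (-Complex.I * lam : ℂ)
  refine ModifiedNLS.exists_profile hσ hV ?_
  filter_upwards [h.ae_slice hV hG, ae_locallyIntegrableOn_slice hV,
    ae_locallyIntegrableOn_slice hG] with y weak_y hV_y hG_y
  exact weak_y.ae_eq_flow hσ hV_y hG_y

theorem IsSolution.exists_profile {c : Space d} {a lam σ : ℝ} (hσ : 0 ≤ σ) {u₀ : Distr d}
    {w : C(ℝ≥0, Distr d)} (hw : IsSolution (affineSymbol c a) lam σ u₀ w) :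
    ∃ A : Space d → ℂ, LocallyIntegrable A ∧
      ∀ᵐ t : ℝ, 0 < t → ∀ φ : 𝓓((⊤ : Opens (Space d)), ℝ),
        w t.toNNReal φ = ∫ x, ((φ x : ℝ) : ℂ) * (wave a t * flow lam σ t (A (x + t • c))) := by
  obtain ⟨U, hU, hNU, w_eq, weak⟩ := hw.equation
  set V := transport (-c) (-a) U with V_def
  have transport_V : transport c a V = U := transport_transport_neg c a U
  have hNV : LocallyIntegrableOn (fun p => nonlin σ (V p)) (spaceTime d) := by
    simp_rw [V_def, nonlin_transport]
    exact locallyIntegrableOn_transport (-c) (-a) hNU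
  rw [← transport_V] at weak
  obtain ⟨A, hA, V_eq⟩ := ((forall_equation_transport_iff c a lam σ V).1 weak).exists_profile hσ
    (locallyIntegrableOn_transport (-c) (-a) hU) hNV
  refine ⟨A, hA, ?_⟩
  filter_upwards [w_eq, V_eq] with t w_eq_t V_eq_t ht φ
  rw [(w_eq_t ht).2]
  refine integral_congr_ae ?_
  filter_upwards [(measurePreserving_add_right (volume : Measure (Space d))
    (t • c)).quasiMeasurePreserving.ae (V_eq_t ht)] with x hx
  rw [← hx, ← transport_V]
  rfl

theorem exists_norm_comp_sub_smul_le {E F : Type*} [NormedAddCommGroup E] [NormedSpace ℝ E]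
    [NormedAddCommGroup F] {f : E → F} (hf : Continuous f) (hfc : HasCompactSupport f) (c : E)
    {I : Set ℝ} (hI : IsCompact I) :
    ∃ K C, IsCompact K ∧ ∀ t ∈ I, ∀ y, ‖f (y - t • c)‖ ≤ K.indicator (fun _ => C) y := by
  obtain ⟨C, hC⟩ := hf.bounded_above_of_compact_support hfc
  refine ⟨(fun p : ℝ × E => p.2 + p.1 • c) '' (I ×ˢ tsupport f), C,
    (hI.prod hfc).image (by fun_prop), fun t ht y => ?_⟩
  by_cases hy : f (y - t • c) = 0
  · rw [hy, norm_zero]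
    exact indicator_nonneg (fun _ _ => (norm_nonneg _).trans (hC 0)) _
  · have mem_image : y ∈ (fun p : ℝ × E => p.2 + p.1 • c) '' (I ×ˢ tsupport f) :=
      ⟨(t, y - t • c), ⟨ht, subset_tsupport f hy⟩, sub_add_cancel y _⟩
    rw [indicator_of_mem mem_image]
    exact hC _

theorem continuous_integral_flow (c : Space d) (a lam : ℝ) {σ : ℝ} (hσ : 0 ≤ σ) {A : Space d → ℂ}
    (hA : LocallyIntegrable A) (φ : 𝓓((⊤ : Opens (Space d)), ℝ)) :
    Continuous fun t : ℝ => ∫ x, ((φ x : ℝ) : ℂ) * (wave a t * flow lam σ t (A (x + t • c))) := by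
  have translate (t : ℝ) : ∫ x, ((φ x : ℝ) : ℂ) * (wave a t * flow lam σ t (A (x + t • c))) =
      ∫ y, ((φ (y - t • c) : ℝ) : ℂ) * (wave a t * flow lam σ t (A y)) := by
    simpa using integral_add_right_eq_self
      (fun y => ((φ (y - t • c) : ℝ) : ℂ) * (wave a t * flow lam σ t (A y))) (t • c)
  have continuous_φ := φ.continuous
  have continuous_wave_a := continuous_wave a
  simp_rw [translate]
  refine continuous_iff_continuousAt.2 fun t₀ => ?_
  obtain ⟨K, C, hK, norm_le⟩ := exists_norm_comp_sub_smul_le φ.continuous φ.hasCompactSupport c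
    (isCompact_closedBall t₀ 1)
  refine continuousAt_of_dominated (bound := K.indicator fun y => C * ‖A y‖)
    (.of_forall fun t => ?_) ?_ ?_ (.of_forall fun y => ?_)
  · have continuous_translate : Continuous fun y : Space d => ((φ (y - t • c) : ℝ) : ℂ) := by
      fun_prop
    exact continuous_translate.aestronglyMeasurable.mul ((aestronglyMeasurable_flow lam hσ
      aestronglyMeasurable_const hA.aestronglyMeasurable).const_mul _)
  · filter_upwards [Metric.closedBall_mem_nhds t₀ one_pos] with t ht
    refine .of_forall fun y => ?_
    rw [norm_mul, norm_mul, norm_wave, norm_flow, one_mul, Complex.norm_real,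
      indicator_mul_left K (fun _ => C) fun y => ‖A y‖]
    exact mul_le_mul_of_nonneg_right (norm_le t ht y) (norm_nonneg _)
  · exact IntegrableOn.integrable_indicator
      ((hA.integrableOn_isCompact hK).norm.const_mul C) hK.measurableSet
  · have continuous_flow_A : Continuous fun t => flow lam σ t (A y) :=
      continuous_flow hσ continuous_id continuous_const
    fun_prop

theorem IsSolution.exists_profile_forall {c : Space d} {a lam σ : ℝ} (hσ : 0 ≤ σ) {u₀ : Distr d}
    {w : C(ℝ≥0, Distr d)} (hw : IsSolution (affineSymbol c a) lam σ u₀ w) :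
    ∃ A : Space d → ℂ, LocallyIntegrable A ∧
      ∀ (t : ℝ≥0) (φ : 𝓓((⊤ : Opens (Space d)), ℝ)),
        w t φ = ∫ x, ((φ x : ℝ) : ℂ) * (wave a t * flow lam σ t (A (x + (t : ℝ) • c))) := by
  obtain ⟨A, hA, w_eq⟩ := hw.exists_profile hσ
  refine ⟨A, hA, fun t φ => ?_⟩
  have continuous_w : Continuous fun t : ℝ => w t.toNNReal φ :=
    (continuous_eval_const φ).comp (w.continuous.comp continuous_real_toNNReal)
  have ae_eq : (fun t : ℝ => w t.toNNReal φ) =ᵐ[volume.restrict (Ici 0)] fun t =>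
      ∫ x, ((φ x : ℝ) : ℂ) * (wave a t * flow lam σ t (A (x + t • c))) := by
    rw [← restrict_Ioi_eq_restrict_Ici]
    refine (ae_restrict_iff' measurableSet_Ioi).2 ?_
    filter_upwards [w_eq] with t ht ht0 using ht ht0 φ
  have eq_at := Measure.eqOn_of_ae_eq ae_eq continuous_w.continuousOn
    (continuous_integral_flow c a lam hσ hA φ).continuousOn
    (by rw [interior_Ici, closure_Ioi]) (mem_Ici.2 t.2)
  have toNNReal_t : (t : ℝ).toNNReal = t := Real.toNNReal_coe
  exact (congrArg (w · φ) toNNReal_t).symm.trans eq_at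

/-- The solution given by a continuous initial datum, as a curve of distributions. -/
def evolutionCurve (c : Space d) (a lam : ℝ) {σ : ℝ} (hσ : 0 ≤ σ) {v : Space d → ℝ}
    (hv : Continuous v) : C(ℝ≥0, Distr d) :=
  toDistrCurve (fun p => evolution c a lam σ v (p.1, p.2))
    ((continuous_evolution c a lam hσ hv).comp (by fun_prop))

theorem evolutionCurve_apply (c : Space d) (a lam : ℝ) {σ : ℝ} (hσ : 0 ≤ σ) {v : Space d → ℝ}
    (hv : Continuous v) (t : ℝ≥0) (φ : 𝓓((⊤ : Opens (Space d)), ℝ)) :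
    evolutionCurve c a lam hσ hv t φ =
      ∫ x, ((φ x : ℝ) : ℂ) * (wave a t * flow lam σ t (v (x + (t : ℝ) • c))) :=
  toDistrCurve_apply _ t φ

theorem evolutionCurve_zero_apply (c : Space d) (a lam : ℝ) {σ : ℝ} (hσ : 0 ≤ σ)
    {v : Space d → ℝ} (hv : Continuous v) (φ : 𝓓((⊤ : Opens (Space d)), ℝ)) :
    evolutionCurve c a lam hσ hv 0 φ = ∫ x, ((φ x : ℝ) : ℂ) * (v x : ℂ) := by
  simp [evolutionCurve_apply, flow_zero]

theorem isSolution_evolutionCurve (c : Space d) (a lam : ℝ) {σ : ℝ} (hσ : 0 ≤ σ)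
    {v : Space d → ℝ} (hv : Continuous v) :
    IsSolution (affineSymbol c a) lam σ (evolutionCurve c a lam hσ hv 0)
      (evolutionCurve c a lam hσ hv) := by
  have hU := continuous_evolution c a lam hσ hv
  refine ⟨rfl, evolution c a lam σ v, hU.locallyIntegrable.locallyIntegrableOn _,
    ((continuous_nonlin hσ).comp hU).locallyIntegrable.locallyIntegrableOn _,
    .of_forall fun t ht => ⟨(hU.comp (by fun_prop)).locallyIntegrable, fun φ => ?_⟩,
    (forall_equation_transport_iff c a lam σ _).2 (hasWeakLineDeriv_flow lam hσ hv)⟩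
  simp_rw [evolutionCurve_apply, Real.coe_toNNReal t ht.le, evolution_apply]

theorem IsSolution.eq_evolutionCurve {c : Space d} {a lam σ : ℝ} (hσ : 0 ≤ σ) {v : Space d → ℝ}
    (hv : Continuous v) {w : C(ℝ≥0, Distr d)}
    (hw : IsSolution (affineSymbol c a) lam σ (evolutionCurve c a lam hσ hv 0) w) :
    w = evolutionCurve c a lam hσ hv := by
  obtain ⟨A, hA, w_eq⟩ := hw.exists_profile_forall hσ
  have profile_eq : ∀ᵐ x, A x = v x := by
    refine ae_eq_of_integral_contDiff_smul_eq hA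
      (Complex.continuous_ofReal.comp hv).locallyIntegrable fun g hg hgc => ?_
    let φ : 𝓓((⊤ : Opens (Space d)), ℝ) := ⟨g, hg, hgc, fun _ _ => trivial⟩
    have initial_eq : w 0 φ = ∫ x, ((φ x : ℝ) : ℂ) * (v x : ℂ) := by
      rw [hw.initial, evolutionCurve_zero_apply]
    rw [w_eq] at initial_eq
    simp only [NNReal.coe_zero, wave_zero_right, one_mul, flow_zero, zero_smul, add_zero]
      at initial_eq
    exact initial_eq
  ext t φ
  rw [w_eq, evolutionCurve_apply]
  refine integral_congr_ae ?_
  filter_upwards [(measurePreserving_add_right (volume : Measure (Space d))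
    ((t : ℝ) • c)).quasiMeasurePreserving.ae profile_eq] with x hx
  rw [hx]

end Uniqueness

end ModifiedNLS

end

theorem proposition1_general (d : ℕ) (hd : 1 ≤ d) (lam σ : ℝ) (hlam : lam ≠ 0) (hσ : 0 < σ)
    (P : ModifiedNLS.Space d → ℝ)
    (hP : ∃ (c : ModifiedNLS.Space d) (a : ℝ), ∀ ξ, P ξ = inner ℝ c ξ + a)
    (δ : ℝ) (hδ : 0 < δ) :
    ∃ u₀ : ModifiedNLS.Distr d,
      ModifiedNLS.MemH ((d : ℝ) / 2) u₀ ∧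
      ModifiedNLS.normH ((d : ℝ) / 2) u₀ ≤ ENNReal.ofReal δ ∧
      ∃ u : C(ℝ≥0, ModifiedNLS.Distr d),
        ModifiedNLS.IsSolution P lam σ u₀ u ∧
        (∀ w : C(ℝ≥0, ModifiedNLS.Distr d), ModifiedNLS.IsSolution P lam σ u₀ w → w = u) ∧
        ∀ t : ℝ≥0, 0 < t → ¬ ModifiedNLS.MemH ((d : ℝ) / 2) (u t) := by
  obtain ⟨c, a, hca⟩ := hP
  obtain rfl : P = ModifiedNLS.affineSymbol c a := funext hca
  have : NeZero d := ⟨by omega⟩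
  obtain ⟨v, hv, ⟨F, hFδ, hF⟩, two_level⟩ := ModifiedNLS.exists_continuous_unbounded_phase
    (e := EuclideanSpace.single (⟨0, hd⟩ : Fin d) (1 : ℝ)) (by simp) hσ hδ
  rw [finrank_euclideanSpace_fin] at hF
  have restrictsTo : ModifiedNLS.RestrictsTo (TemperedDistribution.besselPotential
      (ModifiedNLS.Space d) ℂ (-((d : ℝ) / 2)) (F : 𝓢'(ModifiedNLS.Space d, ℂ)))
      (ModifiedNLS.evolutionCurve c a lam hσ.le hv 0) := fun φ => by
    rw [ModifiedNLS.evolutionCurve_zero_apply,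
      hF _ (ModifiedNLS.hasCompactSupport_testToSchwartz φ)]
    rfl
  exact ⟨_, ModifiedNLS.memH_of_restrictsTo_besselPotential_neg restrictsTo,
    (ModifiedNLS.normH_le_of_restrictsTo_besselPotential_neg restrictsTo).trans <|
      (ofReal_norm F).symm.trans_le (ENNReal.ofReal_le_ofReal hFδ),
    _, ModifiedNLS.isSolution_evolutionCurve c a lam hσ.le hv,
    fun _ hw => hw.eq_evolutionCurve hσ.le hv,
    fun t ht => ModifiedNLS.not_memH_flow hlam (NNReal.coe_pos.2 ht).ne' two_level
      (ModifiedNLS.norm_wave a t) (ModifiedNLS.evolutionCurve_apply c a lam hσ.le hv t)⟩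

theorem proposition1 (d : ℕ) (hd : 1 ≤ d) (lam σ : ℝ) (hlam : lam ≠ 0) (hσ : 0 < σ)
    (hreg : (∃ n : ℕ, σ = n) ∨ ∃ r : ℕ, (r : ℝ) ≤ 2 * σ ∧ (d : ℝ) / 2 < r)
    (P : ModifiedNLS.Space d → ℝ)
    (hP : (∃ c : ModifiedNLS.Space d, ∀ ξ, P ξ = inner ℝ c ξ) ∨ ∃ c : ℝ, ∀ ξ, P ξ = c)
    (δ : ℝ) (hδ : 0 < δ) :
    ∃ u₀ : ModifiedNLS.Distr d,
      ModifiedNLS.MemH ((d : ℝ) / 2) u₀ ∧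
      ModifiedNLS.normH ((d : ℝ) / 2) u₀ ≤ ENNReal.ofReal δ ∧
      ∃ u : C(ℝ≥0, ModifiedNLS.Distr d),
        ModifiedNLS.IsSolution P lam σ u₀ u ∧
        (∀ w : C(ℝ≥0, ModifiedNLS.Distr d), ModifiedNLS.IsSolution P lam σ u₀ w → w = u) ∧
        ∀ t : ℝ≥0, 0 < t → ¬ ModifiedNLS.MemH ((d : ℝ) / 2) (u t) := by
  refine proposition1_general d hd lam σ hlam hσ P ?_ δ hδ
  exact hP.elim (fun ⟨c, hc⟩ => ⟨c, 0, by simpa using hc⟩) fun ⟨a, ha⟩ => ⟨0, a, by simpa using ha⟩
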